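/- **Model.** Time is slotted, $t=0,1,2,\dots$, and there are $r$ queues. The network state $S(t)$ is an irreducible, aperiodic Markov chain on a countable set $\mathcal S$ with a steady state distribution $\pi=(\pi_s)_{s\in\mathcal S}$. Let $T_{ji}=\inf\{T>0: S(T)=i\}$ be the first passage time from $S(0)=j$ to $i$; assume that there is a state $s_1$ with $\mathbb E[T_{js_1}^2]<\infty$ for every $j\in\mathcal S$, and that $\sum_j \Pr(S(0)=j)\,\mathbb E[T_{js_1}^2]<\infty$ (which is automatic if $S(0)$ is deterministic or $\mathcal S$ is finite). In state $s$ the controller chooses an action from a feasible action set $\mathcal X^{(s)}$ (a measurable space, for instance a compact space with its Borel sets). An action $x\in\mathcal X^{(s)}$ incurs a cost $f(s,x)\in\mathbb R$, brings traffic $A_j(s,x)\ge 0$ to queue $j$ and gives service $\mu_j(s,x)\ge 0$ to queue $j$, $j=1,\dots,r$. These functions are measurable in $x$, and their magnitudes are bounded by a constant $\delta_{\max}$ uniformly in $s,x,j$. Assume $\eta$-slackness: for some $\eta>0$ there are actions $x^{(s)}_k\in\mathcal X^{(s)}$ and weights $\vartheta^{(s)}_k\ge 0$, $k=1,\dots,r+2$,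 with $\sum_k\vartheta^{(s)}_k=1$ for all $s$, such that $$\sum_s\pi_s\sum_{k=1}^{r+2}\vartheta^{(s)}_k\big[A_j(s,x^{(s)}_k)-\mu_j(s,x^{(s)}_k)\big]\le-\eta\qquad\text{for all } j .$$ A policy chooses in every slot $t$ an action $x(t)\in\mathcal X^{(S(t))}$, possibly at random, on the basis of $S(t)$ and of the past states and actions; the actions do not influence the evolution of $S$. The backlogs satisfy $q_j(0)=0$ and $q_j(t+1)=\max[q_j(t)-\mu_j(S(t),x(t)),0]+A_j(S(t),x(t))$. A policy is stable if $$\limsup_{t\to\infty}\frac1t\sum_{\tau=0}^{t-1}\sum_{j=1}^r\mathbb E[q_j(\tau)]<\infty ,$$ and $f^*_{av}$ is the infimum, over all stable policies, of the time average cost $\limsup_{t\to\infty}\frac1t\sum_{\tau=0}^{t-1}\mathbb E[f(S(\tau),x(\tau))]$. For $V>0$, the deterministic problem is to minimize $V\sum_s\pi_sf(s,x^{(s)})$ over $x^{(s)}\in\mathcal X^{(s)}$, $s\in\mathcal S$, subject to $\sum_s\pi_sA_j(s,x^{(s)})\le\sum_s\pi_s\mu_j(s,x^{(s)})$ for all $j$.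 Its dual problem is to maximize over $\gamma\in\mathbb R^r$, $\gamma\succeq 0$, the function $$g(\gamma)=\inf_{x^{(s)}\in\mathcal X^{(s)}\ \forall s}\ \sum_s\pi_s\Big\{Vf(s,x^{(s)})+\sum_{j=1}^r\gamma_j\big[A_j(s,x^{(s)})-\mu_j(s,x^{(s)})\big]\Big\}.$$ **Theorem.** Stable policies exist and $f^*_{av}$ is finite; the dual problem has an optimal solution; and every optimal solution $\gamma^*_V$ of the dual problem satisfies $$g(\gamma_V^*)=V f^*_{av},$$ with no convexity assumption on the deterministic problem. In particular $g(\gamma)\le Vf^*_{av}$ for every $\gamma\succeq 0$. -/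

import Mathlib

open MeasureTheory ProbabilityTheory Filter
open scoped ENNReal

namespace QueueNet

/-! ### Markov chains on a countable state space -/

/-- `n`-step transition probabilities of the chain with transition probabilities `P`. -/
noncomputable def stepN {𝒮 : Type*} (P : 𝒮 → PMF 𝒮) : ℕ → 𝒮 → PMF 𝒮
  | 0, i => PMF.pure i
  | n + 1, i => (stepN P n i).bind P

/-- Every state can be reached from every state. -/
def Irreducible {𝒮 : Type*} (P : 𝒮 → PMF 𝒮) : Prop :=
  ∀ i j : 𝒮, ∃ n : ℕ, 0 < stepN P n i j

/-- The period of every state `i`, i.e. the greatest common divisor of the times `n ≥ 1` at which a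
return to `i` is possible, is one. -/
def Aperiodic {𝒮 : Type*} (P : 𝒮 → PMF 𝒮) : Prop :=
  ∀ (i : 𝒮) (d : ℕ), (∀ n : ℕ, 1 ≤ n → 0 < stepN P n i i → d ∣ n) → d = 1

/-- `π` is a steady state distribution of the chain. -/
def IsStationary {𝒮 : Type*} (P : 𝒮 → PMF 𝒮) (π : PMF 𝒮) : Prop :=
  π.bind P = π

/-- `firstPassage P i n j` is the probability that the chain started in `j` at time `0` visits `i`
at time `n` and at none of the times `1, …, n - 1`; that is, `Pr (T = n)` for the first passage time
`T = inf {T > 0 : S(T) = i}` given `S(0) = j`. -/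
noncomputable def firstPassage {𝒮 : Type*} (P : 𝒮 → PMF 𝒮) (i : 𝒮) : ℕ → 𝒮 → ℝ≥0∞
  | 0, _ => 0
  | 1, j => P j i
  | n + 2, j => ∑' k : {k : 𝒮 // k ≠ i}, P j k * firstPassage P i (n + 1) k

/-- The second moment `E[T²]` of the first passage time `T` from `j` to `i`. The last summand is the
contribution of the event `T = ∞` (with `⊤ * 0 = 0`). -/
noncomputable def passageSecondMoment {𝒮 : Type*} (P : 𝒮 → PMF 𝒮) (i j : 𝒮) : ℝ≥0∞ :=
  (∑' n : ℕ, (n : ℝ≥0∞) ^ 2 * firstPassage P i n j) + ⊤ * (1 - ∑' n : ℕ, firstPassage P i n j)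

/-! ### The network -/

/-- The data of a network with `r` queues and network states `𝒮`; the elements of the type `X s` are
the feasible actions in network state `s`. -/
structure Network (r : ℕ) (𝒮 : Type*) (X : 𝒮 → Type*) where
  /-- transition probabilities of the network state process `S(t)` -/
  trans : 𝒮 → PMF 𝒮
  /-- law of `S(0)` -/
  init : PMF 𝒮
  /-- cost `f(s, x)` -/
  cost : (s : 𝒮) → X s → ℝ
  /-- traffic `A_j(s, x)` generated to queue `j` -/
  arr : Fin r → (s : 𝒮) → X s → ℝ
  /-- service `μ_j(s, x)` allocated to queue `j` -/
  srv : Fin r → (s : 𝒮) → X s → ℝ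

/-- A (feasible) action-choosing policy: in slot `t`, given the history
`(S(0), x(0)), …, (S(t-1), x(t-1))` and the observed network state `S(t) = s`, it draws the action
`x(t)` at random from a distribution on the feasible action set `X s`. -/
structure Policy {𝒮 : Type*} (X : 𝒮 → Type*) [∀ s, MeasurableSpace (X s)] where
  rule : (t : ℕ) → (s : 𝒮) → Kernel (Fin t → Σ s, X s) (X s)
  markov : ∀ t s, IsMarkovKernel (rule t s)

/-- Functions of the network state are measurable on the space of state-action pairs. -/
theorem measurable_comp_fst {𝒮 : Type*} {X : 𝒮 → Type*} [∀ s, MeasurableSpace (X s)]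
    (g : 𝒮 → ℝ≥0∞) : Measurable (fun z : Σ s, X s => g z.1) := by
  intro B _
  refine MeasurableSpace.measurableSet_iInf.2 fun s => ?_
  change MeasurableSet ((fun _ : X s => g s) ⁻¹' B)
  by_cases h : g s ∈ B <;> simp [Set.preimage, h]

theorem measurable_sigma_mk {𝒮 : Type*} {X : 𝒮 → Type*} [∀ s, MeasurableSpace (X s)] (s : 𝒮) :
    Measurable (Sigma.mk s : X s → Σ s, X s) :=
  fun _ hB => MeasurableSpace.measurableSet_iInf.1 hB s

/-- A history `z(0), …, z(n)` as a tuple. -/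
def tuple {Z : Type*} (n : ℕ) (h : Finset.Iic n → Z) : Fin (n + 1) → Z :=
  fun i => h ⟨i, Finset.mem_Iic.2 (Nat.lt_succ_iff.1 i.2)⟩

namespace Network

variable {r : ℕ} {𝒮 : Type*} {X : 𝒮 → Type*} [∀ s, MeasurableSpace (X s)]

/-- Law of `(S(0), x(0))`. -/
noncomputable def initLaw (N : Network r 𝒮 X) (p : Policy X) : Measure (Σ s, X s) :=
  Measure.sum fun s => N.init s • (p.rule 0 s Fin.elim0).map (Sigma.mk s)

/-- Conditional law of `(S(n+1), x(n+1))` given the history up to slot `n`: the network state moves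
according to the chain, whatever the actions, and the policy then draws the action. -/
noncomputable def step [Countable 𝒮] (N : Network r 𝒮 X) (p : Policy X) (n : ℕ) :
    Kernel (Finset.Iic n → Σ s, X s) (Σ s, X s) where
  toFun h := Measure.sum fun s =>
    N.trans (h ⟨n, Finset.mem_Iic.2 le_rfl⟩).1 s •
      (p.rule (n + 1) s (tuple n h)).map (Sigma.mk s)
  measurable' := by
    refine Measure.measurable_of_measurable_coe _ fun B hB => ?_
    simp only [Measure.sum_apply _ hB, Measure.smul_apply, smul_eq_mul,
      Measure.map_apply (measurable_sigma_mk _) hB]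
    refine Measurable.tsum fun s => Measurable.mul ?_ ?_
    · exact (measurable_comp_fst fun i => N.trans i s).comp (measurable_pi_apply _)
    · refine (Kernel.measurable_coe _ (measurable_sigma_mk s hB)).comp ?_
      exact measurable_pi_lambda _ fun i => measurable_pi_apply _

instance step_markov [Countable 𝒮] (N : Network r 𝒮 X) (p : Policy X) (n : ℕ) :
    IsMarkovKernel (N.step p n) where
  isProbabilityMeasure h := ⟨by
    have := p.markov
    change (Measure.sum _ : Measure (Σ s, X s)) Set.univ = 1
    simp only [Measure.sum_apply _ MeasurableSet.univ, Measure.smul_apply, smul_eq_mul,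
      Measure.map_apply (measurable_sigma_mk _) MeasurableSet.univ, Set.preimage_univ,
      measure_univ, mul_one]
    exact PMF.tsum_coe _⟩

/-- The law of the whole state-action trajectory `(S(t), x(t))`, `t = 0, 1, 2, …`, under the
policy `p`. -/
noncomputable def law [Countable 𝒮] (N : Network r 𝒮 X) (p : Policy X) :
    Measure (ℕ → Σ s, X s) :=
  Kernel.trajMeasure (X := fun _ => Σ s, X s) (N.initLaw p) (N.step p)

/-- The backlog `q_j(t)` along a state-action trajectory `ω`. -/
noncomputable def backlog (N : Network r 𝒮 X) (ω : ℕ → Σ s, X s) (j : Fin r) : ℕ → ℝ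
  | 0 => 0
  | t + 1 => max (backlog N ω j t - N.srv j (ω t).1 (ω t).2) 0 + N.arr j (ω t).1 (ω t).2

/-- Queue stability: `limsup_t (1/t) ∑_{τ<t} ∑_j E[q_j(τ)] < ∞`. -/
def Stable [Countable 𝒮] (N : Network r 𝒮 X) (p : Policy X) : Prop :=
  limsup (fun t : ℕ => (∑ τ ∈ Finset.range t, ∑ j : Fin r,
    ∫⁻ ω, ENNReal.ofReal (N.backlog ω j τ) ∂(N.law p)) / (t : ℝ≥0∞)) atTop < ⊤

/-- The time average cost `limsup_t (1/t) ∑_{τ<t} E[f(τ)]`. -/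
noncomputable def avgCost [Countable 𝒮] (N : Network r 𝒮 X) (p : Policy X) : ℝ :=
  limsup (fun t : ℕ => (∑ τ ∈ Finset.range t,
    ∫ ω, N.cost (ω τ).1 (ω τ).2 ∂(N.law p)) / (t : ℝ)) atTop

/-- The time average costs of the stable policies. -/
def stableCosts [Countable 𝒮] (N : Network r 𝒮 X) : Set ℝ :=
  {c | ∃ p : Policy X, N.Stable p ∧ c = N.avgCost p}

/-- The optimal time average cost `f*_av` over all stable policies. -/
noncomputable def optCost [Countable 𝒮] (N : Network r 𝒮 X) : ℝ :=
  sInf N.stableCosts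

end Network

/-- The dual function
`g(γ) = inf_x ∑_s π_s { V f(s, x^(s)) + ∑_j γ_j [A_j(s, x^(s)) - μ_j(s, x^(s))] }`
of the deterministic problem. -/
noncomputable def Network.dual {r : ℕ} {𝒮 : Type*} {X : 𝒮 → Type*} (N : Network r 𝒮 X)
    (π : PMF 𝒮) (V : ℝ) (γ : Fin r → ℝ) : ℝ :=
  ⨅ x : (s : 𝒮) → X s, ∑' s : 𝒮, (π s).toReal *
    (V * N.cost s (x s) + ∑ j : Fin r, γ j * (N.arr j s (x s) - N.srv j s (x s)))

/-- `γ` is an optimal solution of the dual problem: maximize `g(γ)` subject to `γ ⪰ 0`. -/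
def Network.IsDualOptimal {r : ℕ} {𝒮 : Type*} {X : 𝒮 → Type*} (N : Network r 𝒮 X)
    (π : PMF 𝒮) (V : ℝ) (γ : Fin r → ℝ) : Prop :=
  0 ≤ γ ∧ ∀ γ' : Fin r → ℝ, 0 ≤ γ' → N.dual π V γ' ≤ N.dual π V γ

/-- The costs, arrivals and services are bounded in magnitude by `δ`, uniformly in states, queues
and actions, and arrivals and services are nonnegative. -/
def Network.Bounded {r : ℕ} {𝒮 : Type*} {X : 𝒮 → Type*} (N : Network r 𝒮 X) (δ : ℝ) : Prop :=
  ∀ (s : 𝒮) (x : X s), |N.cost s x| ≤ δ ∧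
    ∀ j : Fin r, (0 ≤ N.arr j s x ∧ N.arr j s x ≤ δ) ∧ (0 ≤ N.srv j s x ∧ N.srv j s x ≤ δ)

/-- The queue stability constraints are feasible with slackness `η`: some randomization over `r + 2`
actions in every state makes the `π`-average of `A_j - μ_j` at most `-η` for all `j`. -/
def Network.Slack {r : ℕ} {𝒮 : Type*} {X : 𝒮 → Type*} (N : Network r 𝒮 X)
    (π : PMF 𝒮) (η : ℝ) : Prop :=
  ∃ (x : (s : 𝒮) → Fin (r + 2) → X s) (θ : 𝒮 → Fin (r + 2) → ℝ),
    (∀ s k, 0 ≤ θ s k) ∧ (∀ s, ∑ k, θ s k = 1) ∧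
    ∀ j : Fin r, ∑' s : 𝒮, (π s).toReal *
      ∑ k, θ s k * (N.arr j s (x s k) - N.srv j s (x s k)) ≤ -η

end QueueNet

/-! Two inequalities give the identity: every stable policy costs at least `g(γ) / V`, and
randomized stationary policies produce one `γ` for which this bound is sharp.

Weak duality (`Stable.dual_le`). Let `h s` be the infimum over actions of the Lagrangian in state
`s`. Whatever action is taken, `V` times the cost plus the `γ`-weighted drift is at least `h
(S(t))`. Summed over time, the drift of a queue is at most its final expected backlog. Stability
bounds the expected backlogs along infinitely many times, so after division by `t` the drift term
vanishes there. The ergodic theorem `tendsto_expect_cesaro` sends the time average of `h` to its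
`π`-mean, which dominates `g(γ)`.

Strong duality. The pairs (mean cost, mean drift vector) attained by drawing actions from a law `ρ
s` form a convex set, since laws can be mixed; no convexity of costs or action sets enters.
Slackness provides a Slater point, and separation (`exists_multiplier`) gives `γ ⪰ 0` with `V f* ≤ V
cost + γ · drift` on the whole set. Point masses are particular laws, so `V f* ≤ g(γ)`.

The separation uses that a randomized stationary policy with strictly negative mean drifts is stable
(`stable_stationaryPolicy`). The drift is negative only on `π`-average, so the Lyapunov function `q²
/ 2` is corrected by `q` times a solution of the Poisson equation for the state-dependent drift.
That solution is built from expected sums up to the first passage to a fixed state; Kac's formula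
(`passageSum_self_mul`) removes the defect at that state, and second moments of the passage time
control the errors. -/

namespace QueueNet

/-! ### Expectations under a probability mass function. -/

section Expect

variable {𝒮 : Type*}

/-- Expectation of a real function under a probability mass function. -/
noncomputable def expect (μ : PMF 𝒮) (h : 𝒮 → ℝ) : ℝ := ∑' s, (μ s).toReal * h s

/-- Expectation of a nonnegative extended real function under a probability mass function. -/
noncomputable def lexpect (μ : PMF 𝒮) (h : 𝒮 → ℝ≥0∞) : ℝ≥0∞ := ∑' s, μ s * h s

theorem summable_pmf (μ : PMF 𝒮) : Summable fun s => (μ s).toReal :=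
  ENNReal.summable_toReal (by rw [μ.tsum_coe]; exact ENNReal.one_ne_top)

theorem tsum_pmf_toReal (μ : PMF 𝒮) : ∑' s, (μ s).toReal = 1 := by
  rw [← ENNReal.tsum_toReal_eq fun s => μ.apply_ne_top s, μ.tsum_coe, ENNReal.toReal_one]

theorem summable_expect (μ : PMF 𝒮) {h : 𝒮 → ℝ} {M : ℝ} (hM : ∀ s, |h s| ≤ M) :
    Summable fun s => (μ s).toReal * h s := by
  refine Summable.of_norm_bounded ((summable_pmf μ).mul_right M) fun s => ?_
  rw [norm_mul, Real.norm_of_nonneg ENNReal.toReal_nonneg]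
  exact mul_le_mul_of_nonneg_left (hM s) ENNReal.toReal_nonneg

theorem hasSum_expect (μ : PMF 𝒮) {h : 𝒮 → ℝ} {M : ℝ} (hM : ∀ s, |h s| ≤ M) :
    HasSum (fun s => (μ s).toReal * h s) (expect μ h) :=
  (summable_expect μ hM).hasSum

theorem expect_const (μ : PMF 𝒮) (c : ℝ) : expect μ (fun _ => c) = c := by
  rw [expect, tsum_mul_right, tsum_pmf_toReal, one_mul]

theorem expect_mono (μ : PMF 𝒮) {h k : 𝒮 → ℝ} {M K : ℝ} (hM : ∀ s, |h s| ≤ M)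
    (kM : ∀ s, |k s| ≤ K) (hk : ∀ s, h s ≤ k s) : expect μ h ≤ expect μ k :=
  (summable_expect μ hM).tsum_le_tsum
    (fun s => mul_le_mul_of_nonneg_left (hk s) ENNReal.toReal_nonneg) (summable_expect μ kM)

theorem expect_add (μ : PMF 𝒮) {h k : 𝒮 → ℝ} {M K : ℝ} (hM : ∀ s, |h s| ≤ M)
    (kM : ∀ s, |k s| ≤ K) : expect μ (fun s => h s + k s) = expect μ h + expect μ k := by
  simp only [expect, mul_add]
  exact (summable_expect μ hM).tsum_add (summable_expect μ kM)

theorem expect_sub (μ : PMF 𝒮) {h k : 𝒮 → ℝ} {M K : ℝ} (hM : ∀ s, |h s| ≤ M)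
    (kM : ∀ s, |k s| ≤ K) : expect μ (fun s => h s - k s) = expect μ h - expect μ k := by
  simp only [expect, mul_sub]
  exact (summable_expect μ hM).tsum_sub (summable_expect μ kM)

theorem expect_const_mul (μ : PMF 𝒮) (c : ℝ) (h : 𝒮 → ℝ) :
    expect μ (fun s => c * h s) = c * expect μ h := by
  simp only [expect, mul_left_comm _ c]
  exact tsum_mul_left

theorem expect_sum (μ : PMF 𝒮) {ι : Type*} (F : Finset ι) {h : ι → 𝒮 → ℝ} {M : ι → ℝ}
    (hM : ∀ i s, |h i s| ≤ M i) :
    expect μ (fun s => ∑ i ∈ F, h i s) = ∑ i ∈ F, expect μ (h i) := by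
  simp only [expect, Finset.mul_sum]
  exact Summable.tsum_finsetSum fun i _ => summable_expect μ (hM i)

theorem abs_expect_le (μ : PMF 𝒮) {h : 𝒮 → ℝ} {M : ℝ} (hM : ∀ s, |h s| ≤ M) :
    |expect μ h| ≤ M := by
  have h1 : ∀ s : 𝒮, |(fun _ => M) s| ≤ |M| := fun _ => le_rfl
  have h2 : ∀ s : 𝒮, |(fun _ => -M) s| ≤ |M| := fun _ => (abs_neg M).le
  have a := expect_mono μ hM h1 fun s => (abs_le.1 (hM s)).2
  have b := expect_mono μ h2 hM fun s => (abs_le.1 (hM s)).1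
  rw [expect_const] at a b
  exact abs_le.2 ⟨b, a⟩

theorem expect_eq_toReal_lexpect (μ : PMF 𝒮) {h : 𝒮 → ℝ} (h0 : ∀ s, 0 ≤ h s) :
    expect μ h = (lexpect μ fun s => ENNReal.ofReal (h s)).toReal := by
  rw [lexpect, ENNReal.tsum_toReal_eq]
  · simp [expect, ENNReal.toReal_ofReal, h0]
  · exact fun s => ENNReal.mul_ne_top (μ.apply_ne_top s) ENNReal.ofReal_ne_top

theorem lexpect_const (μ : PMF 𝒮) (c : ℝ≥0∞) : lexpect μ (fun _ => c) = c := by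
  rw [lexpect, ENNReal.tsum_mul_right, μ.tsum_coe, one_mul]

theorem lexpect_mono (μ : PMF 𝒮) {h k : 𝒮 → ℝ≥0∞} (hk : ∀ s, h s ≤ k s) :
    lexpect μ h ≤ lexpect μ k :=
  ENNReal.tsum_le_tsum fun s => mul_le_mul_right (hk s) _

theorem lexpect_add (μ : PMF 𝒮) (h k : 𝒮 → ℝ≥0∞) :
    lexpect μ (fun s => h s + k s) = lexpect μ h + lexpect μ k := by
  simp only [lexpect, mul_add]
  exact ENNReal.tsum_add

theorem lexpect_const_mul (μ : PMF 𝒮) (c : ℝ≥0∞) (h : 𝒮 → ℝ≥0∞) :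
    lexpect μ (fun s => c * h s) = c * lexpect μ h := by
  simp only [lexpect, mul_left_comm _ c]
  exact ENNReal.tsum_mul_left

theorem lexpect_bind (μ : PMF 𝒮) (P : 𝒮 → PMF 𝒮) (h : 𝒮 → ℝ≥0∞) :
    lexpect (μ.bind P) h = lexpect μ fun s => lexpect (P s) h := by
  simp only [lexpect, PMF.bind_apply, ← ENNReal.tsum_mul_right, ← ENNReal.tsum_mul_left]
  rw [ENNReal.tsum_comm]
  simp only [mul_assoc]

theorem ofReal_expect (μ : PMF 𝒮) {h : 𝒮 → ℝ} {M : ℝ} (h0 : ∀ s, 0 ≤ h s) (hM : ∀ s, h s ≤ M) :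
    ENNReal.ofReal (expect μ h) = lexpect μ fun s => ENNReal.ofReal (h s) := by
  rw [expect_eq_toReal_lexpect μ h0, ENNReal.ofReal_toReal]
  refine ne_top_of_le_ne_top ?_ (lexpect_mono μ fun s => ENNReal.ofReal_le_ofReal (hM s))
  rw [lexpect_const]
  exact ENNReal.ofReal_ne_top

/-- Adding `M` makes `h` nonnegative, so Tonelli applies through `lexpect_bind`; the constant is
then subtracted. -/
theorem expect_bind (μ : PMF 𝒮) (P : 𝒮 → PMF 𝒮) {h : 𝒮 → ℝ} {M : ℝ} (hM : ∀ s, |h s| ≤ M) :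
    expect (μ.bind P) h = expect μ fun s => expect (P s) h := by
  have h0 : ∀ s, 0 ≤ h s + M := fun s => by linarith [(abs_le.1 (hM s)).1]
  have hb : ∀ s, h s + M ≤ 2 * M := fun s => by linarith [(abs_le.1 (hM s)).2]
  have hc : ∀ s : 𝒮, |(fun _ => M) s| ≤ |M| := fun _ => le_rfl
  have key : expect (μ.bind P) (fun s => h s + M) =
      expect μ fun s => expect (P s) (fun k => h k + M) := by
    rw [expect_eq_toReal_lexpect _ h0, lexpect_bind, expect_eq_toReal_lexpect]
    · simp only [ofReal_expect _ h0 hb]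
    · exact fun s => tsum_nonneg fun k => mul_nonneg ENNReal.toReal_nonneg (h0 k)
  rw [expect_add _ hM hc, expect_const] at key
  simp only [expect_add _ hM hc, expect_const] at key
  rw [expect_add _ (fun s => abs_expect_le (P s) hM) hc, expect_const] at key
  linarith

theorem tendsto_expect (μ : PMF 𝒮) {a : ℕ → 𝒮 → ℝ} {φ : 𝒮 → ℝ} {M : ℝ}
    (hM : ∀ n s, |a n s| ≤ M) (ha : ∀ s, Tendsto (fun n => a n s) atTop (nhds (φ s))) :
    Tendsto (fun n => expect μ (a n)) atTop (nhds (expect μ φ)) := by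
  refine tendsto_tsum_of_dominated_convergence ((summable_pmf μ).mul_right M)
    (fun s => (ha s).const_mul _) (Eventually.of_forall fun n s => ?_)
  rw [norm_mul, Real.norm_of_nonneg ENNReal.toReal_nonneg]
  exact mul_le_mul_of_nonneg_left (hM n s) ENNReal.toReal_nonneg

end Expect

/-! ### Ergodic theorem for time averages of bounded functions of the state. -/

section Ergodic

variable {𝒮 : Type*} (P : 𝒮 → PMF 𝒮)

/-- The transition operator acting on real functions. -/
noncomputable def transOp (h : 𝒮 → ℝ) : 𝒮 → ℝ := fun s => expect (P s) h

variable {P}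

theorem abs_iterate_transOp_le {h : 𝒮 → ℝ} {M : ℝ} (hM : ∀ s, |h s| ≤ M) (n : ℕ) (s : 𝒮) :
    |(transOp P)^[n] h s| ≤ M := by
  induction n generalizing s with
  | zero => exact hM s
  | succ n ih =>
    rw [Function.iterate_succ_apply']
    exact abs_expect_le _ ih

theorem expect_transOp_of_stationary {π : PMF 𝒮} (hπ : IsStationary P π) {h : 𝒮 → ℝ} {M : ℝ}
    (hM : ∀ s, |h s| ≤ M) : expect π (transOp P h) = expect π h := by
  conv_rhs => rw [← (show π.bind P = π from hπ), expect_bind _ _ hM]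
  rfl

theorem expect_iterate_transOp {π : PMF 𝒮} (hπ : IsStationary P π) {h : 𝒮 → ℝ} {M : ℝ}
    (hM : ∀ s, |h s| ≤ M) (n : ℕ) : expect π ((transOp P)^[n] h) = expect π h := by
  induction n with
  | zero => rfl
  | succ n ih =>
    rw [Function.iterate_succ_apply',
      expect_transOp_of_stationary hπ (abs_iterate_transOp_le hM n), ih]

theorem bind_stepN_of_stationary {π : PMF 𝒮} (hπ : IsStationary P π) (n : ℕ) :
    π.bind (stepN P n) = π := by
  induction n with
  | zero => exact π.bind_pure
  | succ n ih =>
    change (π.bind fun i => (stepN P n i).bind P) = π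
    rw [← PMF.bind_bind, ih, hπ]

theorem stationary_pos {π : PMF 𝒮} (hirr : Irreducible P) (hπ : IsStationary P π) (i : 𝒮) :
    0 < (π i).toReal := by
  obtain ⟨k, hk⟩ := π.support_nonempty
  obtain ⟨n, hn⟩ := hirr k i
  refine ENNReal.toReal_pos ?_ (π.apply_ne_top i)
  rw [← PMF.mem_support_iff, ← bind_stepN_of_stationary hπ n, PMF.mem_support_bind_iff]
  exact ⟨k, hk, hn.ne'⟩

/-- Bounded harmonic functions of an irreducible chain with a steady state are constant. -/
theorem harmonic_eq {π : PMF 𝒮} (hirr : Irreducible P) (hπ : IsStationary P π) {φ : 𝒮 → ℝ}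
    {M : ℝ} (hM : ∀ s, |φ s| ≤ M) (hφ : transOp P φ = φ) (i j : 𝒮) : φ i = φ j := by
  have hsq : ∀ s, |φ s * φ s| ≤ M * M := fun s => by
    rw [abs_mul]; exact mul_self_le_mul_self (abs_nonneg _) (hM s)
  have hl : ∀ c : ℝ, ∀ s, |c * φ s| ≤ |c| * M := fun c s => by
    rw [abs_mul]; exact mul_le_mul_of_nonneg_left (hM s) (abs_nonneg _)
  -- For harmonic `φ` this is the conditional variance of one step. Stationarity makes its `π`-mean
  -- zero, and `π` charges every state, so `φ` is unchanged along every possible transition.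
  have hvar : ∀ s, expect (P s) (fun k => (φ k - φ s) * (φ k - φ s)) =
      transOp P (fun k => φ k * φ k) s - φ s * φ s := by
    intro s
    have e : (fun k => (φ k - φ s) * (φ k - φ s)) =
        fun k => (φ k * φ k - (2 * φ s) * φ k) + φ s * φ s := by
      funext k; ring
    have hc : ∀ k : 𝒮, |(fun _ => φ s * φ s) k| ≤ M * M := fun _ => hsq s
    have hd : ∀ k, |φ k * φ k - (2 * φ s) * φ k| ≤ M * M + |2 * φ s| * M := fun k =>
      (abs_sub _ _).trans (add_le_add (hsq k) (hl _ k))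
    rw [e, expect_add _ hd hc, expect_sub _ hsq (hl _), expect_const, expect_const_mul]
    have := congrFun hφ s
    simp only [transOp] at this ⊢
    rw [this]; ring
  have hbd : ∀ s k, |(φ k - φ s) * (φ k - φ s)| ≤ (M + M) * (M + M) := fun s k => by
    rw [abs_mul]
    exact mul_self_le_mul_self (abs_nonneg _) ((abs_sub _ _).trans (add_le_add (hM k) (hM s)))
  have hv0 : ∀ s, 0 ≤ expect (P s) (fun k => (φ k - φ s) * (φ k - φ s)) := fun s =>
    tsum_nonneg fun k => mul_nonneg ENNReal.toReal_nonneg (mul_self_nonneg _)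
  have htot : expect π (fun s => expect (P s) (fun k => (φ k - φ s) * (φ k - φ s))) = 0 := by
    simp only [hvar]
    have hT : ∀ s, |transOp P (fun k => φ k * φ k) s| ≤ M * M := fun s =>
      abs_expect_le (P s) hsq
    rw [expect_sub _ hT hsq]
    exact sub_eq_zero.2 (expect_transOp_of_stationary hπ hsq)
  have hz : ∀ s, expect (P s) (fun k => (φ k - φ s) * (φ k - φ s)) = 0 := by
    intro s
    have hs := hasSum_expect π fun s => abs_expect_le (P s) (hbd s)
    have h1 := (hasSum_zero_iff_of_nonneg
      fun s => mul_nonneg ENNReal.toReal_nonneg (hv0 s)).1 (htot ▸ hs)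
    have h2 := congrFun h1 s
    exact (mul_eq_zero.1 h2).resolve_left (stationary_pos hirr hπ s).ne'
  have hedge : ∀ s k, P s k ≠ 0 → φ k = φ s := by
    intro s k hsk
    have h1 := (hasSum_zero_iff_of_nonneg
      fun k => mul_nonneg ENNReal.toReal_nonneg (mul_self_nonneg (φ k - φ s))).1
        (hz s ▸ hasSum_expect (P s) (hbd s))
    have h2 := (mul_eq_zero.1 (congrFun h1 k)).resolve_left
      (ENNReal.toReal_pos hsk ((P s).apply_ne_top k)).ne'
    exact sub_eq_zero.1 (mul_self_eq_zero.1 h2)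
  have hpath : ∀ n k, k ∈ (stepN P n i).support → φ i = φ k := by
    intro n
    induction n with
    | zero =>
      intro k hk
      rw [show stepN P 0 i = PMF.pure i from rfl, PMF.mem_support_pure_iff] at hk
      rw [hk]
    | succ n ih =>
      intro k hk
      rw [show stepN P (n + 1) i = (stepN P n i).bind P from rfl, PMF.mem_support_bind_iff] at hk
      obtain ⟨m, hm, hmk⟩ := hk
      rw [ih m hm, hedge m k hmk]
  obtain ⟨n, hn⟩ := hirr i j
  exact hpath n j hn.ne'

/-- Time averages of the iterates of the transition operator. -/
noncomputable def cesaro (P : 𝒮 → PMF 𝒮) (h : 𝒮 → ℝ) (t : ℕ) : 𝒮 → ℝ :=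
  fun s => (t : ℝ)⁻¹ * ∑ τ ∈ Finset.range t, (transOp P)^[τ] h s

theorem abs_cesaro_le {h : 𝒮 → ℝ} {M : ℝ} (hM : ∀ s, |h s| ≤ M) (t : ℕ) (s : 𝒮) :
    |cesaro P h t s| ≤ M := by
  have hM0 : 0 ≤ M := (abs_nonneg _).trans (hM s)
  rcases Nat.eq_zero_or_pos t with rfl | ht
  · simpa [cesaro] using hM0
  · have ht' : (0 : ℝ) < t := Nat.cast_pos.2 ht
    rw [cesaro, abs_mul, abs_of_pos (inv_pos.2 ht'), inv_mul_le_iff₀ ht']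
    refine (Finset.abs_sum_le_sum_abs _ _).trans ?_
    refine (Finset.sum_le_sum fun τ _ => abs_iterate_transOp_le hM τ s).trans ?_
    simp

theorem expect_cesaro (μ : PMF 𝒮) {h : 𝒮 → ℝ} {M : ℝ} (hM : ∀ s, |h s| ≤ M) (t : ℕ) :
    expect μ (cesaro P h t) =
      (t : ℝ)⁻¹ * ∑ τ ∈ Finset.range t, expect μ ((transOp P)^[τ] h) := by
  unfold cesaro
  rw [expect_const_mul, expect_sum _ _ fun τ s => abs_iterate_transOp_le hM τ s]

/-- Telescoping leaves only the two end terms, of size `O(1/t)`; hence every limit point of the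
averages is harmonic. -/
theorem transOp_cesaro_sub {h : 𝒮 → ℝ} {M : ℝ} (hM : ∀ s, |h s| ≤ M) (t : ℕ) (s : 𝒮) :
    transOp P (cesaro P h t) s - cesaro P h t s =
      (t : ℝ)⁻¹ * ((transOp P)^[t] h s - h s) := by
  rw [transOp, expect_cesaro _ hM, cesaro, ← mul_sub, ← Finset.sum_sub_distrib]
  congr 1
  have := Finset.sum_range_sub (fun τ => (transOp P)^[τ] h s) t
  simpa only [Function.iterate_succ_apply', transOp, Function.iterate_zero_apply] using this

/-- The ergodic theorem for bounded functions, pointwise in the initial state. -/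
theorem tendsto_cesaro [Countable 𝒮] {π : PMF 𝒮} (hirr : Irreducible P) (hπ : IsStationary P π)
    {h : 𝒮 → ℝ} {M : ℝ} (hM : ∀ s, |h s| ≤ M) (s : 𝒮) :
    Tendsto (fun t => cesaro P h t s) atTop (nhds (expect π h)) := by
  refine tendsto_of_subseq_tendsto fun ns hns => ?_
  -- With countably many states the product of intervals is sequentially compact, so it suffices to
  -- identify the pointwise limit points of the averages.
  have hK : IsCompact (Set.pi Set.univ fun _ : 𝒮 => Set.Icc (-M) M) :=
    isCompact_univ_pi fun _ => isCompact_Icc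
  obtain ⟨φ, -, ms, hms, hlim⟩ := hK.isSeqCompact (x := fun n => cesaro P h (ns n))
    fun n => by rw [Set.mem_univ_pi]; exact fun s => abs_le.1 (abs_cesaro_le hM (ns n) s)
  have hlim' := tendsto_pi_nhds.1 hlim
  have hsub : Tendsto (fun n => ns (ms n)) atTop atTop := hns.comp hms.tendsto_atTop
  have hφM : ∀ s, |φ s| ≤ M := fun s =>
    le_of_tendsto (hlim' s).abs (Eventually.of_forall fun n => abs_cesaro_le hM _ s)
  have hharm : transOp P φ = φ := by
    funext s
    have h1 : Tendsto (fun n => transOp P (cesaro P h (ns (ms n))) s) atTop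
        (nhds (transOp P φ s)) := tendsto_expect _ (fun n => abs_cesaro_le hM _) hlim'
    have h2 : Tendsto (fun n => transOp P (cesaro P h (ns (ms n))) s - cesaro P h (ns (ms n)) s)
        atTop (nhds 0) := by
      simp only [transOp_cesaro_sub hM]
      have h3 : Tendsto (fun n => ((ns (ms n) : ℕ) : ℝ)⁻¹ * (M + M)) atTop (nhds 0) := by
        simpa using ((tendsto_inv_atTop_zero (𝕜 := ℝ)).comp
          (tendsto_natCast_atTop_atTop.comp hsub)).mul_const (M + M)
      refine squeeze_zero_norm (fun n => ?_) h3
      rw [norm_mul, Real.norm_of_nonneg (inv_nonneg.2 (Nat.cast_nonneg _))]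
      exact mul_le_mul_of_nonneg_left ((abs_sub _ _).trans
        (add_le_add (abs_iterate_transOp_le hM _ s) (hM s))) (inv_nonneg.2 (Nat.cast_nonneg _))
    have h4 := h1.sub (hlim' s)
    exact sub_eq_zero.1 (tendsto_nhds_unique h4 h2)
  have hconst : φ = fun _ => φ s := funext fun k => harmonic_eq hirr hπ hφM hharm k s
  -- All averages with `t > 0` have the same `π`-mean as `h`, and dominated convergence carries this
  -- mean to the constant limit.
  have hval : expect π h = φ s := by
    have h1 : Tendsto (fun n => expect π (cesaro P h (ns (ms n)))) atTop (nhds (expect π φ)) :=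
      tendsto_expect _ (fun n => abs_cesaro_le hM _) hlim'
    have h2 : expect π φ = φ s := by
      conv_lhs => rw [hconst]
      exact expect_const π _
    rw [h2] at h1
    refine tendsto_nhds_unique (tendsto_const_nhds.congr' ?_) h1
    filter_upwards [hsub.eventually_gt_atTop 0] with n hn
    rw [expect_cesaro _ hM]
    simp only [expect_iterate_transOp hπ hM, Finset.sum_const, Finset.card_range, nsmul_eq_mul]
    rw [inv_mul_cancel_left₀ (Nat.cast_ne_zero.2 hn.ne')]
  exact ⟨ms, hval ▸ hlim' s⟩

/-- The ergodic theorem for bounded functions, for an arbitrary initial law. -/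
theorem tendsto_expect_cesaro [Countable 𝒮] {π : PMF 𝒮} (hirr : Irreducible P)
    (hπ : IsStationary P π) {h : 𝒮 → ℝ} {M : ℝ} (hM : ∀ s, |h s| ≤ M) (ν : PMF 𝒮) :
    Tendsto (fun t : ℕ => (∑ τ ∈ Finset.range t, expect ν ((transOp P)^[τ] h)) / t) atTop
      (nhds (expect π h)) := by
  have := tendsto_expect ν (fun t => abs_cesaro_le hM t)
    (fun s => tendsto_cesaro hirr hπ hM s)
  rw [expect_const] at this
  refine this.congr fun t => ?_
  rw [expect_cesaro _ hM, div_eq_inv_mul]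

end Ergodic

/-! ### First passage functionals through the killed transition operator. -/

section Taboo

variable {𝒮 : Type*} (P : 𝒮 → PMF 𝒮)

/-- The transition operator acting on nonnegative extended real functions. -/
noncomputable def ltransOp (g : 𝒮 → ℝ≥0∞) : 𝒮 → ℝ≥0∞ := fun s => lexpect (P s) g

/-- The transition operator killed at the state `i`. -/
noncomputable def taboo (i : 𝒮) (g : 𝒮 → ℝ≥0∞) : 𝒮 → ℝ≥0∞ :=
  fun s => ∑' k : {k : 𝒮 // k ≠ i}, P s k * g k

/-- The expected sum of `g` over the times before the first passage to `i`. -/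
noncomputable def passageSum (i : 𝒮) (g : 𝒮 → ℝ≥0∞) : 𝒮 → ℝ≥0∞ :=
  fun s => ∑' n : ℕ, (taboo P i)^[n] g s

/-- The expected first passage time to `i`. -/
noncomputable def passageMean (i : 𝒮) : 𝒮 → ℝ≥0∞ := passageSum P i 1

/-- The expectation of `T (T + 1) / 2` for the first passage time `T` to `i`. -/
noncomputable def passageQuad (i : 𝒮) : 𝒮 → ℝ≥0∞ :=
  fun s => ∑' n : ℕ, ((n : ℝ≥0∞) + 1) * (taboo P i)^[n] 1 s

variable {P} {i : 𝒮}

theorem taboo_add_self (g : 𝒮 → ℝ≥0∞) (s : 𝒮) :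
    taboo P i g s + P s i * g i = ltransOp P g s := by
  have h := ENNReal.summable.tsum_add_tsum_compl (s := ({i} : Set 𝒮))
    (f := fun k => P s k * g k) ENNReal.summable
  rw [tsum_singleton i (fun k => P s k * g k)] at h
  rw [add_comm]
  exact h

theorem taboo_add (g k : 𝒮 → ℝ≥0∞) : taboo P i (g + k) = taboo P i g + taboo P i k := by
  funext s
  simp only [taboo, Pi.add_apply, mul_add]
  exact ENNReal.tsum_add

theorem taboo_smul (c : ℝ≥0∞) (g : 𝒮 → ℝ≥0∞) : taboo P i (c • g) = c • taboo P i g := by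
  funext s
  simp only [taboo, Pi.smul_apply, smul_eq_mul, mul_left_comm _ c]
  exact ENNReal.tsum_mul_left

theorem taboo_mono : Monotone (taboo P i) := fun _ _ h _ =>
  ENNReal.tsum_le_tsum fun k => mul_le_mul_right (h k) _

theorem taboo_tsum (f : ℕ → 𝒮 → ℝ≥0∞) :
    taboo P i (fun s => ∑' n, f n s) = fun s => ∑' n, taboo P i (f n) s := by
  funext s
  simp only [taboo, ← ENNReal.tsum_mul_left]
  exact ENNReal.tsum_comm

theorem iterate_taboo_add (g k : 𝒮 → ℝ≥0∞) (n : ℕ) :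
    (taboo P i)^[n] (g + k) = (taboo P i)^[n] g + (taboo P i)^[n] k := by
  induction n with
  | zero => rfl
  | succ n ih => simp only [Function.iterate_succ_apply', ih, taboo_add]

theorem iterate_taboo_smul (c : ℝ≥0∞) (g : 𝒮 → ℝ≥0∞) (n : ℕ) :
    (taboo P i)^[n] (c • g) = c • (taboo P i)^[n] g := by
  induction n with
  | zero => rfl
  | succ n ih => simp only [Function.iterate_succ_apply', ih, taboo_smul]

/-- The iterate is the probability that the passage time `T` exceeds `n`. -/
theorem iterate_taboo_one_le (n : ℕ) (s : 𝒮) : (taboo P i)^[n] 1 s ≤ 1 := by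
  induction n generalizing s with
  | zero => exact le_rfl
  | succ n ih =>
    rw [Function.iterate_succ_apply']
    refine (taboo_mono (show (taboo P i)^[n] 1 ≤ 1 from ih) s).trans ?_
    have h := taboo_add_self (P := P) (i := i) 1 s
    refine (le_self_add.trans_eq h).trans_eq ?_
    exact lexpect_const (P s) 1

/-- First-step decomposition: the terms with `n ≥ 1` are the killed operator applied to the whole
series. -/
theorem passageSum_eq (g : 𝒮 → ℝ≥0∞) (s : 𝒮) :
    passageSum P i g s = g s + taboo P i (passageSum P i g) s := by
  have h : taboo P i (passageSum P i g) s = ∑' n, (taboo P i)^[n + 1] g s := by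
    simp only [Function.iterate_succ_apply']
    exact congrFun (taboo_tsum fun n => (taboo P i)^[n] g) s
  rw [h]
  exact tsum_eq_zero_add' ENNReal.summable

theorem passageQuad_eq (s : 𝒮) :
    passageQuad P i s = passageMean P i s + taboo P i (passageQuad P i) s := by
  have h : taboo P i (passageQuad P i) s = ∑' n : ℕ, (n : ℝ≥0∞) * (taboo P i)^[n] 1 s := by
    have h1 := congrFun (taboo_tsum (P := P) (i := i)
      fun n => ((n : ℝ≥0∞) + 1) • (taboo P i)^[n] 1) s
    simp only [taboo_smul, ← Function.iterate_succ_apply'] at h1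
    rw [tsum_eq_zero_add' ENNReal.summable]
    simp only [Nat.cast_zero, zero_mul, zero_add, Nat.cast_add, Nat.cast_one]
    exact h1
  rw [h, passageMean, passageSum, ← ENNReal.tsum_add]
  exact tsum_congr fun n => by ring

theorem passageSum_le {g : 𝒮 → ℝ≥0∞} {M : ℝ≥0∞} (hg : ∀ s, g s ≤ M) (s : 𝒮) :
    passageSum P i g s ≤ M * passageMean P i s := by
  rw [passageMean, passageSum, passageSum, ← ENNReal.tsum_mul_left]
  refine ENNReal.tsum_le_tsum fun n => ?_
  have h : g ≤ M • (1 : 𝒮 → ℝ≥0∞) := fun s => by simpa using hg s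
  have h1 := (taboo_mono (P := P) (i := i)).iterate n h s
  rw [iterate_taboo_smul] at h1
  exact h1

theorem passageMean_le_quad (s : 𝒮) : passageMean P i s ≤ passageQuad P i s :=
  (passageQuad_eq s).symm ▸ le_self_add

/-- A form of `E[T]² ≤ E[T(T+1)]`. It uses only that the tail probabilities `u n` lie in `[0, 1]`:
adding `u N` to a partial sum raises the square by at most `2 (N + 1) u N`. -/
theorem passageMean_sq_le {s : 𝒮} (hs : passageQuad P i s ≠ ⊤) :
    passageMean P i s * passageMean P i s ≤ 2 * passageQuad P i s := by
  have hfin : passageMean P i s ≠ ⊤ := ne_top_of_le_ne_top hs (passageMean_le_quad s)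
  set u : ℕ → ℝ≥0∞ := fun n => (taboo P i)^[n] 1 s with hu
  have hu1 : ∀ n, u n ≤ 1 := fun n => iterate_taboo_one_le n s
  have hS : ∀ N : ℕ, ∑ n ∈ Finset.range N, u n ≤ N := fun N =>
    (Finset.sum_le_sum fun n _ => hu1 n).trans (by simp)
  have hN : ∀ N : ℕ, (∑ n ∈ Finset.range N, u n) * (∑ n ∈ Finset.range N, u n) ≤
      2 * ∑ n ∈ Finset.range N, ((n : ℝ≥0∞) + 1) * u n := by
    intro N
    induction N with
    | zero => simp
    | succ N ih =>
      rw [Finset.sum_range_succ, Finset.sum_range_succ]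
      calc (∑ n ∈ Finset.range N, u n + u N) * (∑ n ∈ Finset.range N, u n + u N)
          = (∑ n ∈ Finset.range N, u n) * (∑ n ∈ Finset.range N, u n) +
            2 * ((∑ n ∈ Finset.range N, u n) * u N) + u N * u N := by ring
        _ ≤ 2 * ∑ n ∈ Finset.range N, ((n : ℝ≥0∞) + 1) * u n + 2 * (N * u N) + 2 * (1 * u N) := by
            refine add_le_add (add_le_add ih ?_) ?_
            · gcongr
              exact hS N
            · exact (mul_le_mul_left (hu1 N) _).trans (le_mul_of_one_le_left zero_le one_le_two)
        _ = _ := by ring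
  have h1 : Tendsto (fun N => ∑ n ∈ Finset.range N, u n) atTop (nhds (passageMean P i s)) :=
    ENNReal.tendsto_nat_tsum u
  refine le_of_tendsto (ENNReal.Tendsto.mul h1 (Or.inr hfin) h1 (Or.inr hfin))
    (Eventually.of_forall fun N => (hN N).trans ?_)
  exact mul_le_mul_right (ENNReal.sum_le_tsum _) _

theorem firstPassage_succ (n : ℕ) :
    firstPassage P i (n + 1) = (taboo P i)^[n] fun s => P s i := by
  induction n with
  | zero => rfl
  | succ n ih =>
    rw [Function.iterate_succ_apply', ← ih]
    rfl

/-- From `T > n`, either `T = n + 1` or `T > n + 1`. -/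
theorem iterate_taboo_one_eq (n : ℕ) (s : 𝒮) :
    (taboo P i)^[n] 1 s = firstPassage P i (n + 1) s + (taboo P i)^[n + 1] 1 s := by
  have h : (1 : 𝒮 → ℝ≥0∞) = (fun s => P s i) + taboo P i 1 := by
    funext s
    have h := taboo_add_self (P := P) (i := i) 1 s
    rw [show ltransOp P 1 s = 1 from lexpect_const (P s) 1] at h
    simp only [Pi.one_apply, mul_one] at h
    rw [Pi.add_apply, add_comm]
    exact h.symm
  conv_lhs => rw [h, iterate_taboo_add]
  rw [firstPassage_succ, Function.iterate_succ_apply]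
  rfl

/-- Summation by parts turns tail probabilities into point probabilities; the boundary term `N² P(T
> N)` is absorbed by the tail of the second moment. -/
theorem passageQuad_le_secondMoment {s : 𝒮} (hs : passageSecondMoment P i s ≠ ⊤) :
    passageQuad P i s ≤ passageSecondMoment P i s := by
  set f : ℕ → ℝ≥0∞ := fun n => firstPassage P i (n + 1) s with hf
  set u : ℕ → ℝ≥0∞ := fun n => (taboo P i)^[n] 1 s with hu
  have hfu : ∀ n, u n = f n + u (n + 1) := fun n => iterate_taboo_one_eq n s
  have hu1 : ∀ n, u n ≤ 1 := fun n => iterate_taboo_one_le n s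
  have hufin : ∀ n, u n ≠ ⊤ := fun n => ne_top_of_le_ne_top ENNReal.one_ne_top (hu1 n)
  have hsplit : ∀ c : ℕ → ℝ≥0∞, c 0 * firstPassage P i 0 s = 0 →
      ∑' n, c n * firstPassage P i n s = ∑' n, c (n + 1) * f n := by
    intro c hc
    rw [tsum_eq_zero_add' ENNReal.summable, hc, zero_add]
  have hzero : firstPassage P i 0 s = 0 := rfl
  have hsum : ∑' n, firstPassage P i n s = ∑' n, f n := by
    simpa using hsplit 1 (by simp [hzero])
  have hpart : ∀ N, ∑ n ∈ Finset.range N, f n + u N = 1 := by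
    intro N
    induction N with
    | zero => simp [hu]
    | succ N ih => rw [Finset.sum_range_succ, add_assoc, ← hfu, ih]
  have hle : ∑' n, f n ≤ 1 := by
    rw [ENNReal.tsum_eq_iSup_nat]
    exact iSup_le fun N => le_self_add.trans_eq (hpart N)
  -- An infinite passage time is weighted by `⊤`, so a finite second moment forces the passage to
  -- happen almost surely.
  have hone : ∑' n, f n = 1 := by
    by_contra hne
    refine hs ?_
    rw [passageSecondMoment, hsum, ENNReal.top_mul, add_top]
    exact (tsub_pos_of_lt (lt_of_le_of_ne hle hne)).ne'
  have htail : ∀ N, u N = ∑' n, f (n + N) := by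
    intro N
    have h1 := ENNReal.summable.sum_add_tsum_nat_add' (f := f) (k := N)
    rw [hone, ← hpart N] at h1
    refine ((ENNReal.add_right_inj ?_).1 h1).symm
    exact ne_top_of_le_ne_top ENNReal.one_ne_top (le_self_add.trans_eq (hpart N))
  have hmom : passageSecondMoment P i s = ∑' n : ℕ, ((n : ℝ≥0∞) + 1) ^ 2 * f n := by
    rw [passageSecondMoment, hsum, hone, tsub_self, mul_zero, add_zero, hsplit]
    · simp
    · simp
  rw [hmom, passageQuad, ENNReal.tsum_eq_iSup_nat]
  refine iSup_le fun N => ?_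
  have hab : ∀ N : ℕ, ∑ n ∈ Finset.range N, ((n : ℝ≥0∞) + 1) * u n ≤
      ∑ n ∈ Finset.range N, ((n : ℝ≥0∞) + 1) ^ 2 * f n + (N : ℝ≥0∞) ^ 2 * u N := by
    intro N
    induction N with
    | zero => simp
    | succ N ih =>
      rw [Finset.sum_range_succ, Finset.sum_range_succ]
      calc _ ≤ ∑ n ∈ Finset.range N, ((n : ℝ≥0∞) + 1) ^ 2 * f n + (N : ℝ≥0∞) ^ 2 * u N +
            ((N : ℝ≥0∞) + 1) * u N := by gcongr
        _ = ∑ n ∈ Finset.range N, ((n : ℝ≥0∞) + 1) ^ 2 * f n +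
            ((N : ℝ≥0∞) ^ 2 + N + 1) * u N := by ring
        _ ≤ ∑ n ∈ Finset.range N, ((n : ℝ≥0∞) + 1) ^ 2 * f n +
            ((N : ℝ≥0∞) + 1) ^ 2 * u N := by
            gcongr
            calc (N : ℝ≥0∞) ^ 2 + N + 1 ≤ (N : ℝ≥0∞) ^ 2 + N + 1 + N := le_self_add
              _ = _ := by ring
        _ = _ := by rw [hfu N]; push_cast; ring
  refine (hab N).trans ?_
  rw [← ENNReal.summable.sum_add_tsum_nat_add'
    (f := fun n : ℕ => ((n : ℝ≥0∞) + 1) ^ 2 * f n) (k := N), htail, ← ENNReal.tsum_mul_left]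
  refine add_le_add_right (ENNReal.tsum_le_tsum fun n => ?_) _
  gcongr
  push_cast
  calc (N : ℝ≥0∞) ≤ N + (n + 1) := le_self_add
    _ = _ := by ring

end Taboo

/-! ### Growth of passage moments along the chain, and Kac's formula. -/

section Kac

variable {𝒮 : Type*} {P : 𝒮 → PMF 𝒮} {i : 𝒮}

/-- The expectation of `g (S(t))` for the chain with initial law `ν`. -/
noncomputable def lmean (P : 𝒮 → PMF 𝒮) (ν : PMF 𝒮) (g : 𝒮 → ℝ≥0∞) (t : ℕ) : ℝ≥0∞ :=
  lexpect ν ((ltransOp P)^[t] g)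

theorem ltransOp_add (g k : 𝒮 → ℝ≥0∞) :
    ltransOp P (fun s => g s + k s) = fun s => ltransOp P g s + ltransOp P k s :=
  funext fun s => lexpect_add (P s) g k

theorem ltransOp_const_mul (c : ℝ≥0∞) (g : 𝒮 → ℝ≥0∞) :
    ltransOp P (fun s => c * g s) = fun s => c * ltransOp P g s :=
  funext fun s => lexpect_const_mul (P s) c g

theorem lmean_add (ν : PMF 𝒮) (g k : 𝒮 → ℝ≥0∞) (t : ℕ) :
    lmean P ν (fun s => g s + k s) t = lmean P ν g t + lmean P ν k t := by
  induction t generalizing g k with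
  | zero => exact lexpect_add ν g k
  | succ t ih =>
    simp only [lmean, Function.iterate_succ_apply, ltransOp_add] at ih ⊢
    exact ih _ _

theorem lmean_const_mul (ν : PMF 𝒮) (c : ℝ≥0∞) (g : 𝒮 → ℝ≥0∞) (t : ℕ) :
    lmean P ν (fun s => c * g s) t = c * lmean P ν g t := by
  induction t generalizing g with
  | zero => exact lexpect_const_mul ν c g
  | succ t ih =>
    simp only [lmean, Function.iterate_succ_apply, ltransOp_const_mul] at ih ⊢
    exact ih _

theorem lmean_const (ν : PMF 𝒮) (c : ℝ≥0∞) (t : ℕ) : lmean P ν (fun _ => c) t = c := by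
  induction t with
  | zero => exact lexpect_const ν c
  | succ t ih =>
    have h : ltransOp P (fun _ => c) = fun _ => c := funext fun s => lexpect_const (P s) c
    simp only [lmean, Function.iterate_succ_apply, h] at ih ⊢
    exact ih

theorem lmean_mono (ν : PMF 𝒮) {g k : 𝒮 → ℝ≥0∞} (h : ∀ s, g s ≤ k s) (t : ℕ) :
    lmean P ν g t ≤ lmean P ν k t := by
  have hm : Monotone (ltransOp P) := fun _ _ h s => lexpect_mono (P s) h
  exact lexpect_mono ν (hm.iterate t h)

theorem lmean_ltransOp (ν : PMF 𝒮) (g : 𝒮 → ℝ≥0∞) (t : ℕ) :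
    lmean P ν (ltransOp P g) t = lmean P ν g (t + 1) := by
  rw [lmean, lmean, Function.iterate_succ_apply]

theorem lmean_ofReal (ν : PMF 𝒮) {h : 𝒮 → ℝ} {M : ℝ} (h0 : ∀ s, 0 ≤ h s) (hM : ∀ s, |h s| ≤ M)
    (t : ℕ) : lmean P ν (fun s => ENNReal.ofReal (h s)) t =
      ENNReal.ofReal (expect ν ((transOp P)^[t] h)) := by
  induction t generalizing h with
  | zero => exact (ofReal_expect ν h0 fun s => (abs_le.1 (hM s)).2).symm
  | succ t ih =>
    have e : ltransOp P (fun s => ENNReal.ofReal (h s)) =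
        fun s => ENNReal.ofReal (transOp P h s) :=
      funext fun s => (ofReal_expect (P s) h0 fun s => (abs_le.1 (hM s)).2).symm
    rw [← lmean_ltransOp, e, ih (h := transOp P h) (fun s => tsum_nonneg fun k =>
      mul_nonneg ENNReal.toReal_nonneg (h0 k)) (fun s => abs_expect_le (P s) hM),
      Function.iterate_succ_apply]

/-- A Poisson equation for `g` with a defect: the killed operator misses the jump into `i`, worth
`passageSum P i g i * P s i`. -/
theorem passageSum_add_eq (g : 𝒮 → ℝ≥0∞) (s : 𝒮) :
    passageSum P i g s + passageSum P i g i * P s i = g s + ltransOp P (passageSum P i g) s := by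
  rw [← taboo_add_self (i := i), mul_comm (P s i), ← add_assoc, ← passageSum_eq g s]

/-- A Foster drift inequality: one step lowers the quadratic functional by the mean passage time,
except for restarting at `i`. Summed in time, it makes the quadratic mean and the accumulated mean
passage times grow at most linearly. -/
theorem ltransOp_passageQuad_add_le (s : 𝒮) :
    ltransOp P (passageQuad P i) s + passageMean P i s ≤
      passageQuad P i s + passageQuad P i i := by
  rw [← taboo_add_self (i := i), passageQuad_eq s]
  calc _ = passageMean P i s + taboo P i (passageQuad P i) s + P s i * passageQuad P i i := by ring
    _ ≤ passageMean P i s + taboo P i (passageQuad P i) s + 1 * passageQuad P i i := by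
      gcongr; exact (P s).coe_le_one i
    _ = _ := by rw [one_mul]

theorem lmean_passageQuad_add_sum_le (ν : PMF 𝒮) (t : ℕ) :
    lmean P ν (passageQuad P i) t + ∑ τ ∈ Finset.range t, lmean P ν (passageMean P i) τ ≤
      lexpect ν (passageQuad P i) + t * passageQuad P i i := by
  induction t with
  | zero => simp [lmean]
  | succ t ih =>
    rw [Finset.sum_range_succ]
    have h1 := lmean_mono (P := P) ν (ltransOp_passageQuad_add_le (P := P) (i := i)) t
    rw [lmean_add, lmean_add, lmean_const, lmean_ltransOp] at h1
    calc _ = (lmean P ν (passageQuad P i) (t + 1) + lmean P ν (passageMean P i) t) +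
          ∑ τ ∈ Finset.range t, lmean P ν (passageMean P i) τ := by ring
      _ ≤ (lmean P ν (passageQuad P i) t + passageQuad P i i) +
          ∑ τ ∈ Finset.range t, lmean P ν (passageMean P i) τ := by gcongr
      _ = (lmean P ν (passageQuad P i) t +
          ∑ τ ∈ Finset.range t, lmean P ν (passageMean P i) τ) + passageQuad P i i := by ring
      _ ≤ (lexpect ν (passageQuad P i) + t * passageQuad P i i) + passageQuad P i i := by gcongr
      _ = _ := by push_cast; ring

theorem sum_lmean_passageSum (ν : PMF 𝒮) (g : 𝒮 → ℝ≥0∞) (t : ℕ) :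
    lmean P ν (passageSum P i g) 0 +
        passageSum P i g i * ∑ τ ∈ Finset.range t, lmean P ν (fun s => P s i) τ =
      ∑ τ ∈ Finset.range t, lmean P ν g τ + lmean P ν (passageSum P i g) t := by
  induction t with
  | zero => simp
  | succ t ih =>
    rw [Finset.sum_range_succ, Finset.sum_range_succ, mul_add, ← add_assoc, ih]
    have h : lmean P ν (fun s => passageSum P i g s + passageSum P i g i * P s i) t =
        lmean P ν (fun s => g s + ltransOp P (passageSum P i g) s) t := by
      simp only [passageSum_add_eq]
    rw [lmean_add, lmean_add, lmean_const_mul, lmean_ltransOp] at h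
    rw [add_assoc, h]
    ring

/-- Pointwise, `a w ≤ a²` if `w ≤ a`, and otherwise `a w ≤ w² ≤ 2 W`. The parameter `a` is free, to
be tuned to the time. -/
theorem lmean_passageMean_le (ν : PMF 𝒮) (hW : ∀ s, passageQuad P i s ≠ ⊤) (a : ℝ≥0∞) (t : ℕ) :
    a * lmean P ν (passageMean P i) t ≤ a * a + 2 * lmean P ν (passageQuad P i) t := by
  rw [← lmean_const_mul, ← lmean_const_mul, ← lmean_const (P := P) ν (a * a) t, ← lmean_add]
  refine lmean_mono ν (fun s => ?_) t
  rcases le_total a (passageMean P i s) with h | h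
  · exact ((mul_le_mul_left h _).trans (passageMean_sq_le (hW s))).trans le_add_self
  · exact (mul_le_mul_right h a).trans le_self_add

theorem lmean_passageQuad_ne_top {ν : PMF 𝒮} (hW : ∀ s, passageQuad P i s ≠ ⊤)
    (hν : lexpect ν (passageQuad P i) ≠ ⊤) (t : ℕ) : lmean P ν (passageQuad P i) t ≠ ⊤ :=
  ne_top_of_le_ne_top (ENNReal.add_ne_top.2 ⟨hν, ENNReal.mul_ne_top (ENNReal.natCast_ne_top t)
    (hW i)⟩) (le_self_add.trans (lmean_passageQuad_add_sum_le ν t))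

theorem lmean_passageMean_ne_top {ν : PMF 𝒮} (hW : ∀ s, passageQuad P i s ≠ ⊤)
    (hν : lexpect ν (passageQuad P i) ≠ ⊤) (t : ℕ) : lmean P ν (passageMean P i) t ≠ ⊤ :=
  ne_top_of_le_ne_top (lmean_passageQuad_ne_top hW hν t)
    (lmean_mono ν passageMean_le_quad t)

theorem tendsto_lmean_passageMean_div {ν : PMF 𝒮} (hW : ∀ s, passageQuad P i s ≠ ⊤)
    (hν : lexpect ν (passageQuad P i) ≠ ⊤) :
    Tendsto (fun t : ℕ => (lmean P ν (passageMean P i) t).toReal / t) atTop (nhds 0) := by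
  set A := (lexpect ν (passageQuad P i)).toReal
  set C := (passageQuad P i i).toReal
  have hlim : Tendsto (fun t : ℕ => (1 + 2 * A + 2 * C) / Real.sqrt t) atTop (nhds 0) :=
    tendsto_const_nhds.div_atTop
      (Real.tendsto_sqrt_atTop.comp tendsto_natCast_atTop_atTop)
  refine squeeze_zero' (Eventually.of_forall fun t => by positivity) ?_ hlim
  filter_upwards [eventually_ge_atTop 1] with t ht
  have ht' : (1 : ℝ) ≤ t := by exact_mod_cast ht
  have hsq : Real.sqrt t * Real.sqrt t = t := Real.mul_self_sqrt (by positivity)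
  have hspos : 0 < Real.sqrt t := Real.sqrt_pos.2 (by positivity)
  -- The choice `a = √t` balances `a² = t` against the linear growth of the quadratic mean, so the
  -- mean passage time is `O(√t)`.
  have h1 := lmean_passageMean_le ν hW (ENNReal.ofReal (Real.sqrt t)) t
  have h2 := le_self_add.trans (lmean_passageQuad_add_sum_le (P := P) (i := i) ν t)
  have h3 := h1.trans (add_le_add_right (mul_le_mul_right h2 2) _)
  have hq : (t : ℝ≥0∞) * passageQuad P i i ≠ ⊤ :=
    ENNReal.mul_ne_top (ENNReal.natCast_ne_top t) (hW i)
  have h4 := ENNReal.toReal_mono (ENNReal.add_ne_top.2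
    ⟨ENNReal.mul_ne_top ENNReal.ofReal_ne_top ENNReal.ofReal_ne_top,
      ENNReal.mul_ne_top ENNReal.ofNat_ne_top (ENNReal.add_ne_top.2 ⟨hν, hq⟩)⟩) h3
  rw [ENNReal.toReal_mul, ENNReal.toReal_add (ENNReal.mul_ne_top ENNReal.ofReal_ne_top
    ENNReal.ofReal_ne_top) (ENNReal.mul_ne_top ENNReal.ofNat_ne_top
    (ENNReal.add_ne_top.2 ⟨hν, hq⟩)), ENNReal.toReal_mul, ENNReal.toReal_mul,
    ENNReal.toReal_add hν hq, ENNReal.toReal_mul, ENNReal.toReal_ofReal (Real.sqrt_nonneg _),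
    hsq, ENNReal.toReal_natCast, ENNReal.toReal_ofNat] at h4
  have hA : 0 ≤ A := ENNReal.toReal_nonneg
  rw [div_le_div_iff₀ (by positivity) hspos]
  nlinarith [mul_le_mul_of_nonneg_left ht' hA]

/-- Kac's formula: the expected sum of `h` over an excursion from `i`. -/
theorem passageSum_self_mul [Countable 𝒮] {π ν : PMF 𝒮} (hirr : Irreducible P)
    (hπ : IsStationary P π) (hW : ∀ s, passageQuad P i s ≠ ⊤)
    (hν : lexpect ν (passageQuad P i) ≠ ⊤) {h : 𝒮 → ℝ} {M : ℝ} (h0 : ∀ s, 0 ≤ h s)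
    (hM : ∀ s, |h s| ≤ M) :
    (passageSum P i (fun s => ENNReal.ofReal (h s)) i).toReal * (π i).toReal = expect π h := by
  set g : 𝒮 → ℝ≥0∞ := fun s => ENNReal.ofReal (h s) with hg
  have hgM : ∀ s, g s ≤ ENNReal.ofReal M := fun s =>
    ENNReal.ofReal_le_ofReal (abs_le.1 (hM s)).2
  have hΦle := passageSum_le (P := P) (i := i) hgM
  have hM0 : 0 ≤ M := (abs_nonneg _).trans (hM i)
  have hΦm : ∀ t, lmean P ν (passageSum P i g) t ≤
      ENNReal.ofReal M * lmean P ν (passageMean P i) t := fun t => by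
    rw [← lmean_const_mul]
    exact lmean_mono ν hΦle t
  have hMw : ∀ t, ENNReal.ofReal M * lmean P ν (passageMean P i) t ≠ ⊤ := fun t =>
    ENNReal.mul_ne_top ENNReal.ofReal_ne_top (lmean_passageMean_ne_top hW hν t)
  have hΦfin : ∀ t, lmean P ν (passageSum P i g) t ≠ ⊤ := fun t =>
    ne_top_of_le_ne_top (hMw t) (hΦm t)
  have hcfin : passageSum P i g i ≠ ⊤ := ne_top_of_le_ne_top
    (ENNReal.mul_ne_top ENNReal.ofReal_ne_top
      (ne_top_of_le_ne_top (hW i) (passageMean_le_quad i))) (hΦle i)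
  set p : 𝒮 → ℝ := fun s => (P s i).toReal with hp
  have hp0 : ∀ s, 0 ≤ p s := fun s => ENNReal.toReal_nonneg
  have hp1 : ∀ s, |p s| ≤ 1 := fun s => by
    rw [abs_of_nonneg (hp0 s)]
    exact ENNReal.toReal_le_of_le_ofReal zero_le_one (by simpa using (P s).coe_le_one i)
  have hpe : (fun s => P s i) = fun s => ENNReal.ofReal (p s) :=
    funext fun s => (ENNReal.ofReal_toReal ((P s).apply_ne_top i)).symm
  have hpπ : expect π p = (π i).toReal := by
    rw [expect_eq_toReal_lexpect π hp0, ← hpe]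
    congr 1
    conv_rhs => rw [← (show π.bind P = π from hπ)]
    rfl
  have hnn : ∀ (f : 𝒮 → ℝ), (∀ s, 0 ≤ f s) → ∀ n, 0 ≤ expect ν ((transOp P)^[n] f) := by
    intro f hf n
    have h1 : ∀ n s, 0 ≤ (transOp P)^[n] f s := by
      intro n
      induction n with
      | zero => exact hf
      | succ n ih =>
        intro s
        rw [Function.iterate_succ_apply']
        exact tsum_nonneg fun k => mul_nonneg ENNReal.toReal_nonneg (ih k)
    exact tsum_nonneg fun k => mul_nonneg ENNReal.toReal_nonneg (h1 n k)
  have hid : ∀ t : ℕ, (lmean P ν (passageSum P i g) 0).toReal +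
      (passageSum P i g i).toReal * ∑ τ ∈ Finset.range t, expect ν ((transOp P)^[τ] p) =
      ∑ τ ∈ Finset.range t, expect ν ((transOp P)^[τ] h) +
        (lmean P ν (passageSum P i g) t).toReal := by
    intro t
    have h1 := congrArg ENNReal.toReal (sum_lmean_passageSum (P := P) (i := i) ν g t)
    rw [hpe] at h1
    simp only [lmean_ofReal ν hp0 hp1] at h1
    simp only [hg] at h1
    simp only [lmean_ofReal ν h0 hM] at h1
    rw [ENNReal.toReal_add (hΦfin 0) (ENNReal.mul_ne_top hcfin
        (ENNReal.sum_ne_top.2 fun _ _ => ENNReal.ofReal_ne_top)),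
      ENNReal.toReal_add (ENNReal.sum_ne_top.2 fun _ _ => ENNReal.ofReal_ne_top) (hΦfin t),
      ENNReal.toReal_mul, ENNReal.toReal_sum fun _ _ => ENNReal.ofReal_ne_top,
      ENNReal.toReal_sum fun _ _ => ENNReal.ofReal_ne_top] at h1
    simpa only [ENNReal.toReal_ofReal (hnn p hp0 _), ENNReal.toReal_ofReal (hnn h h0 _)] using h1
  have hL1 := (tendsto_expect_cesaro hirr hπ hp1 ν).const_mul (passageSum P i g i).toReal
  have hL0 : Tendsto (fun t : ℕ => (lmean P ν (passageSum P i g) 0).toReal / (t : ℝ)) atTop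
      (nhds 0) := tendsto_const_nhds.div_atTop tendsto_natCast_atTop_atTop
  have hR1 := tendsto_expect_cesaro hirr hπ hM ν
  have hR2 : Tendsto (fun t : ℕ => (lmean P ν (passageSum P i g) t).toReal / (t : ℝ)) atTop
      (nhds 0) := by
    have h1 := (tendsto_lmean_passageMean_div hW hν).const_mul M
    rw [mul_zero] at h1
    refine squeeze_zero (fun t => by positivity) (fun t => ?_) h1
    rw [← mul_div_assoc]
    refine div_le_div_of_nonneg_right ?_ (Nat.cast_nonneg t)
    have h2 := ENNReal.toReal_mono (hMw t) (hΦm t)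
    rwa [ENNReal.toReal_mul, ENNReal.toReal_ofReal hM0] at h2
  -- Divided by `t`, the two boundary terms vanish, the frequency of jumps into `i` tends to `π i`,
  -- and the average of `h` to its `π`-mean.
  have hlim := tendsto_nhds_unique ((hL0.add hL1).congr fun t => ?_) (hR1.add hR2)
  · rw [zero_add, add_zero, hpπ] at hlim
    exact hlim
  · rw [← mul_div_assoc, ← add_div, ← add_div, hid]

end Kac

/-! ### Measurability on state-action pairs, stationary policies and pathwise backlog bounds. -/

theorem measurable_of_sigma {𝒮 : Type*} {X : 𝒮 → Type*} [∀ s, MeasurableSpace (X s)] {β : Type*}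
    [MeasurableSpace β] {k : (Σ s, X s) → β} (hk : ∀ s, Measurable fun x : X s => k ⟨s, x⟩) :
    Measurable k := fun _ hB => MeasurableSpace.measurableSet_iInf.2 fun s => hk s hB

theorem measurable_comp_fst_real {𝒮 : Type*} {X : 𝒮 → Type*} [∀ s, MeasurableSpace (X s)]
    (h : 𝒮 → ℝ) : Measurable fun z : Σ s, X s => h z.1 :=
  measurable_of_sigma fun s => (measurable_const : Measurable fun _ : X s => h s)

/-- Extension of a finite history to an infinite trajectory. -/
def extendHist {Z : Type*} (n : ℕ) (y : Finset.Iic n → Z) : ℕ → Z :=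
  fun m => if h : m ≤ n then y ⟨m, Finset.mem_Iic.2 h⟩ else y ⟨n, Finset.mem_Iic.2 le_rfl⟩

theorem measurable_extendHist {Z : Type*} [MeasurableSpace Z] (n : ℕ) :
    Measurable (extendHist (Z := Z) n) := by
  refine measurable_pi_lambda _ fun m => ?_
  by_cases h : m ≤ n
  · simpa only [extendHist, h, dite_true] using measurable_pi_apply _
  · simpa only [extendHist, h, dite_false] using measurable_pi_apply _

/-- The policy that draws the action in network state `s` from `ρ s`, independently of the past. -/
noncomputable def stationaryPolicy {𝒮 : Type*} {X : 𝒮 → Type*} [∀ s, MeasurableSpace (X s)]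
    (ρ : ∀ s, Measure (X s)) [∀ s, IsProbabilityMeasure (ρ s)] : Policy X where
  rule _ s := Kernel.const _ (ρ s)
  markov _ _ := inferInstance

namespace Network

section Backlog

variable {r : ℕ} {𝒮 : Type*} {X : 𝒮 → Type*}

theorem measurable_backlog [∀ s, MeasurableSpace (X s)] (N : Network r 𝒮 X)
    (harr : ∀ j s, Measurable (N.arr j s))
    (hsrv : ∀ j s, Measurable (N.srv j s)) (j : Fin r) (t : ℕ) :
    Measurable fun ω => N.backlog ω j t := by
  induction t with
  | zero => exact measurable_const
  | succ t ih =>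
    have h1 : Measurable fun z : Σ s, X s => N.srv j z.1 z.2 := measurable_of_sigma (hsrv j)
    have h2 : Measurable fun z : Σ s, X s => N.arr j z.1 z.2 := measurable_of_sigma (harr j)
    exact ((ih.sub (h1.comp (measurable_pi_apply t))).max measurable_const).add
      (h2.comp (measurable_pi_apply t))

theorem backlog_congr (N : Network r 𝒮 X) (j : Fin r) {t : ℕ} {ω ω' : ℕ → Σ s, X s} (h : ∀ m < t, ω m = ω' m) :
    N.backlog ω j t = N.backlog ω' j t := by
  induction t with
  | zero => rfl
  | succ t ih =>
    rw [backlog, backlog, ih fun m hm => h m (hm.trans (Nat.lt_succ_self t)),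
      h t (Nat.lt_succ_self t)]

variable {N : Network r 𝒮 X} {δ : ℝ}

theorem backlog_nonneg (hδ : N.Bounded δ) (ω : ℕ → Σ s, X s) (j : Fin r) (t : ℕ) :
    0 ≤ N.backlog ω j t := by
  cases t with
  | zero => exact le_rfl
  | succ t => exact add_nonneg (le_max_right _ _) ((hδ _ _).2 j).1.1

theorem backlog_succ_le (hδ : N.Bounded δ) (ω : ℕ → Σ s, X s) (j : Fin r) (t : ℕ) :
    N.backlog ω j (t + 1) ≤ N.backlog ω j t + δ := by
  have h := (hδ (ω t).1 (ω t).2).2 j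
  exact add_le_add (max_le (by linarith [h.2.1]) (backlog_nonneg hδ ω j t)) h.1.2

theorem le_backlog_succ (ω : ℕ → Σ s, X s) (j : Fin r) (t : ℕ) :
    N.backlog ω j t - N.srv j (ω t).1 (ω t).2 + N.arr j (ω t).1 (ω t).2 ≤ N.backlog ω j (t + 1) :=
  add_le_add_left (le_max_left _ _) _

theorem backlog_le (hδ : N.Bounded δ) (ω : ℕ → Σ s, X s) (j : Fin r) (t : ℕ) :
    N.backlog ω j t ≤ t * δ := by
  induction t with
  | zero => simp [backlog]
  | succ t ih =>
    refine (backlog_succ_le hδ ω j t).trans ?_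
    push_cast
    linarith

/-- If the queue does not empty, the square expands exactly. If it empties, `(q - m)² ≥ 0` replaces
the lost term. In both cases `a² + m² ≤ 2 δ²` bounds the remainder. -/
theorem backlog_succ_sq_le (hδ : N.Bounded δ) (ω : ℕ → Σ s, X s) (j : Fin r) (t : ℕ) :
    N.backlog ω j (t + 1) ^ 2 ≤ N.backlog ω j t ^ 2 + 2 * δ ^ 2 +
      2 * (N.backlog ω j t * (N.arr j (ω t).1 (ω t).2 - N.srv j (ω t).1 (ω t).2)) := by
  have h := (hδ (ω t).1 (ω t).2).2 j
  have hq := backlog_nonneg hδ ω j t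
  simp only [backlog]
  generalize N.backlog ω j t = q at *
  generalize N.arr j (ω t).1 (ω t).2 = a at *
  generalize N.srv j (ω t).1 (ω t).2 = m at *
  obtain ⟨⟨a0, a1⟩, m0, m1⟩ := h
  rcases max_cases (q - m) 0 with ⟨e, -⟩ | ⟨e, hm⟩
  · rw [e]; nlinarith [mul_nonneg a0 m0]
  · rw [e]; nlinarith [mul_nonneg a0 hq, mul_nonneg a0 (sub_nonneg.2 a1)]

end Backlog

theorem abs_integral_action_le {𝒮 : Type*} {X : 𝒮 → Type*} [∀ s, MeasurableSpace (X s)]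
    (ρ : ∀ s, Measure (X s)) [∀ s, IsProbabilityMeasure (ρ s)]
    {k : (Σ s, X s) → ℝ} {M : ℝ} (hM : ∀ z, |k z| ≤ M) (s : 𝒮) :
    |∫ x, k ⟨s, x⟩ ∂(ρ s)| ≤ M := by
  have h := norm_integral_le_of_norm_le_const (μ := ρ s) (f := fun x => k ⟨s, x⟩) (C := M)
    (Eventually.of_forall fun x => hM _)
  simpa using h

end Network

/-! ### Conditioning under the trajectory law. -/

namespace Network

variable {r : ℕ} {𝒮 : Type*} {X : 𝒮 → Type*} [∀ s, MeasurableSpace (X s)]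
  (N : Network r 𝒮 X) (p : Policy X)

instance initLaw_isProbabilityMeasure : IsProbabilityMeasure (N.initLaw p) := ⟨by
  have := p.markov
  simp only [initLaw, Measure.sum_apply _ MeasurableSet.univ, Measure.smul_apply, smul_eq_mul,
    Measure.map_apply (measurable_sigma_mk _) MeasurableSet.univ, Set.preimage_univ,
    measure_univ, mul_one]
  exact PMF.tsum_coe _⟩

variable [Countable 𝒮]

instance law_isProbabilityMeasure : IsProbabilityMeasure (N.law p) := by
  unfold law; infer_instance

theorem lintegral_step {n : ℕ} (y : Finset.Iic n → Σ s, X s) {k : (Σ s, X s) → ℝ≥0∞}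
    (hk : Measurable k) : ∫⁻ z, k z ∂(N.step p n y) =
      ∑' s, N.trans (y ⟨n, Finset.mem_Iic.2 le_rfl⟩).1 s *
        ∫⁻ x, k ⟨s, x⟩ ∂(p.rule (n + 1) s (tuple n y)) := by
  change ∫⁻ z, k z ∂(Measure.sum _) = _
  rw [lintegral_sum_measure]
  refine tsum_congr fun s => ?_
  rw [lintegral_smul_measure, lintegral_map hk (measurable_sigma_mk s)]
  rfl

/-- Conditioning on the first `n + 1` slots. -/
theorem lintegral_law_succ {n : ℕ} {F : (ℕ → Σ s, X s) → ℝ≥0∞} (hF : Measurable F)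
    (hdep : DependsOn F (Set.Iic n)) {k : (Σ s, X s) → ℝ≥0∞} (hk : Measurable k) :
    ∫⁻ ω, F ω * k (ω (n + 1)) ∂(N.law p) =
      ∫⁻ ω, F ω * (∑' s, N.trans (ω n).1 s *
        ∫⁻ x, k ⟨s, x⟩ ∂(p.rule (n + 1) s (tuple n (Preorder.frestrictLe n ω)))) ∂(N.law p) := by
  -- Since `F` reads only the slots up to `n`, it factors through the restricted history, and the
  -- disintegration of the trajectory law applies.
  have hFe : ∀ ω, F (extendHist n (Preorder.frestrictLe n ω)) = F ω := fun ω =>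
    hdep fun m hm => by simp [extendHist, show m ≤ n from hm]
  have hmF : Measurable fun y : Finset.Iic n → Σ s, X s => F (extendHist n y) :=
    hF.comp (measurable_extendHist n)
  have hG : Measurable fun q : (Finset.Iic n → Σ s, X s) × Σ s, X s =>
      F (extendHist n q.1) * k q.2 :=
    (hmF.comp measurable_fst).mul (hk.comp measurable_snd)
  have hmr : Measurable (Preorder.frestrictLe (π := fun _ : ℕ => Σ s, X s) n) :=
    Preorder.measurable_frestrictLe n
  have hpair : Measurable fun ω : ℕ → Σ s, X s => (Preorder.frestrictLe n ω, ω (n + 1)) :=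
    hmr.prodMk (measurable_pi_apply _)
  calc ∫⁻ ω, F ω * k (ω (n + 1)) ∂(N.law p)
      = ∫⁻ ω, F (extendHist n (Preorder.frestrictLe n ω)) * k (ω (n + 1)) ∂(N.law p) := by
        simp only [hFe]
    _ = ∫⁻ q, F (extendHist n q.1) * k q.2
          ∂((N.law p).map fun ω => (Preorder.frestrictLe n ω, ω (n + 1))) :=
        (lintegral_map hG hpair).symm
    _ = ∫⁻ q, F (extendHist n q.1) * k q.2
          ∂(((N.law p).map (Preorder.frestrictLe n)) ⊗ₘ (N.step p n)) := by
        rw [law, Kernel.map_frestrictLe_trajMeasure_compProd_eq_map_trajMeasure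
          (X := fun _ => Σ s, X s)]
    _ = ∫⁻ ω, ∫⁻ z, F ω * k z ∂(N.step p n (Preorder.frestrictLe n ω)) ∂(N.law p) := by
        rw [Measure.lintegral_compProd hG, lintegral_map hG.lintegral_kernel_prod_right' hmr]
        simp only [hFe]
    _ = _ := by
        refine lintegral_congr fun ω => ?_
        rw [lintegral_const_mul _ hk, lintegral_step N p _ hk]
        rfl

theorem lintegral_law_zero {k : (Σ s, X s) → ℝ≥0∞} (hk : Measurable k) :
    ∫⁻ ω, k (ω 0) ∂(N.law p) =
      ∑' s, N.init s * ∫⁻ x, k ⟨s, x⟩ ∂(p.rule 0 s Fin.elim0) := by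
  have hmr : Measurable (Preorder.frestrictLe (π := fun _ : ℕ => Σ s, X s) 0) :=
    Preorder.measurable_frestrictLe 0
  have h0 : (N.law p).map (Preorder.frestrictLe 0) = (N.initLaw p).map
      (MeasurableEquiv.piUnique (fun i : Finset.Iic 0 => Σ s, X s)).symm := by
    rw [law, Kernel.trajMeasure, Measure.map_comp _ _ hmr, Kernel.traj_map_frestrictLe,
      Kernel.partialTraj_self, Measure.id_comp]
  have hev : Measurable fun y : Finset.Iic 0 → Σ s, X s => k (y ⟨0, Finset.mem_Iic.2 le_rfl⟩) :=
    hk.comp (measurable_pi_apply _)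
  calc ∫⁻ ω, k (ω 0) ∂(N.law p)
      = ∫⁻ y, k (y ⟨0, Finset.mem_Iic.2 le_rfl⟩)
          ∂((N.law p).map (Preorder.frestrictLe 0)) := (lintegral_map hev hmr).symm
    _ = ∫⁻ z, k z ∂(N.initLaw p) := by
        rw [h0, lintegral_map hev (MeasurableEquiv.measurable _)]
        rfl
    _ = _ := by
        rw [initLaw, lintegral_sum_measure]
        refine tsum_congr fun s => ?_
        rw [lintegral_smul_measure, lintegral_map hk (measurable_sigma_mk s)]
        rfl

/-- For a function of the next state alone the action integrates to one, so the policy drops out. -/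
theorem lintegral_mul_state_succ {n : ℕ} {F : (ℕ → Σ s, X s) → ℝ≥0∞} (hF : Measurable F)
    (hdep : DependsOn F (Set.Iic n)) (g : 𝒮 → ℝ≥0∞) :
    ∫⁻ ω, F ω * g (ω (n + 1)).1 ∂(N.law p) =
      ∫⁻ ω, F ω * ltransOp N.trans g (ω n).1 ∂(N.law p) := by
  have := p.markov
  rw [lintegral_law_succ N p hF hdep (k := fun z => g z.1) (measurable_comp_fst g)]
  simp [ltransOp, lexpect]

theorem dependsOn_const_fun {α β : Type*} {c : β} (S : Set ℕ) :
    DependsOn (fun _ : ℕ → α => c) S := fun _ _ _ => rfl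

/-- The network states form a Markov chain under every policy. -/
theorem lintegral_state (g : 𝒮 → ℝ≥0∞) (t : ℕ) :
    ∫⁻ ω, g (ω t).1 ∂(N.law p) = lmean N.trans N.init g t := by
  induction t generalizing g with
  | zero =>
    have := p.markov
    rw [lintegral_law_zero N p (k := fun z => g z.1) (measurable_comp_fst g)]
    simp [lmean, lexpect]
  | succ t ih =>
    have h := lintegral_mul_state_succ N p (n := t) (F := fun _ => 1) measurable_const
      (dependsOn_const_fun _) g
    simp only [one_mul] at h
    rw [h, ih, lmean_ltransOp]

variable (ρ : ∀ s, Measure (X s)) [∀ s, IsProbabilityMeasure (ρ s)]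

/-- Given the state, a stationary policy draws its action independently of the past, so `k` may be
replaced by its mean under `ρ`. -/
theorem lintegral_mul_stationary_succ {n : ℕ} {F : (ℕ → Σ s, X s) → ℝ≥0∞} (hF : Measurable F)
    (hdep : DependsOn F (Set.Iic n)) {k : (Σ s, X s) → ℝ≥0∞} (hk : Measurable k) :
    ∫⁻ ω, F ω * k (ω (n + 1)) ∂(N.law (stationaryPolicy ρ)) =
      ∫⁻ ω, F ω * (∫⁻ x, k ⟨(ω (n + 1)).1, x⟩ ∂(ρ (ω (n + 1)).1))
        ∂(N.law (stationaryPolicy ρ)) := by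
  rw [lintegral_law_succ N _ hF hdep hk,
    lintegral_mul_state_succ N _ hF hdep (fun s => ∫⁻ x, k ⟨s, x⟩ ∂(ρ s))]
  rfl

theorem lintegral_stationary {k : (Σ s, X s) → ℝ≥0∞} (hk : Measurable k) (t : ℕ) :
    ∫⁻ ω, k (ω t) ∂(N.law (stationaryPolicy ρ)) =
      ∫⁻ ω, (∫⁻ x, k ⟨(ω t).1, x⟩ ∂(ρ (ω t).1)) ∂(N.law (stationaryPolicy ρ)) := by
  cases t with
  | zero =>
    rw [lintegral_law_zero N _ hk, lintegral_state N _ (fun s => ∫⁻ x, k ⟨s, x⟩ ∂(ρ s))]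
    rfl
  | succ t =>
    have h := lintegral_mul_stationary_succ N ρ (n := t) (F := fun _ => 1) measurable_const
      (dependsOn_const_fun _) hk
    simpa only [one_mul] using h

end Network

theorem iterate_transOp_add_const {𝒮 : Type*} {P : 𝒮 → PMF 𝒮} {h : 𝒮 → ℝ} {M : ℝ}
    (hM : ∀ s, |h s| ≤ M) (c : ℝ) (t : ℕ) :
    (transOp P)^[t] (fun s => h s + c) = fun s => (transOp P)^[t] h s + c := by
  induction t with
  | zero => rfl
  | succ t ih =>
    rw [Function.iterate_succ_apply', Function.iterate_succ_apply', ih]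
    funext s
    rw [transOp, expect_add (M := M) (K := |c|) _ (abs_iterate_transOp_le hM t) (fun _ => le_rfl),
      expect_const]
    rfl

namespace Network

variable {r : ℕ} {𝒮 : Type*} [Countable 𝒮] {X : 𝒮 → Type*} [∀ s, MeasurableSpace (X s)]
  (N : Network r 𝒮 X) (p : Policy X)

theorem integrable_law {k : (Σ s, X s) → ℝ} (hk : Measurable k) {M : ℝ} (hM : ∀ z, |k z| ≤ M)
    (t : ℕ) : Integrable (fun ω => k (ω t)) (N.law p) :=
  Integrable.of_bound (hk.comp (measurable_pi_apply t)).aestronglyMeasurable M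
    (Eventually.of_forall fun _ => hM _)

theorem integral_state {h : 𝒮 → ℝ} {M : ℝ} (hM : ∀ s, |h s| ≤ M) (t : ℕ) :
    ∫ ω, h (ω t).1 ∂(N.law p) = expect N.init ((transOp N.trans)^[t] h) := by
  have h0 : ∀ s, 0 ≤ h s + M := fun s => by linarith [(abs_le.1 (hM s)).1]
  have h1 : ∀ s, |h s + M| ≤ M + |M| := fun s =>
    (abs_add_le _ _).trans (add_le_add_left (hM s) _)
  have key : ∫ ω, (h (ω t).1 + M) ∂(N.law p) =
      expect N.init ((transOp N.trans)^[t] fun s => h s + M) := by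
    rw [integral_eq_lintegral_of_nonneg_ae (Eventually.of_forall fun ω => h0 _)
      ((measurable_comp_fst_real fun s => h s + M).comp
        (measurable_pi_apply t)).aestronglyMeasurable,
      lintegral_state N p (fun s => ENNReal.ofReal (h s + M)), lmean_ofReal _ h0 h1,
      ENNReal.toReal_ofReal]
    rw [iterate_transOp_add_const hM]
    exact tsum_nonneg fun k => mul_nonneg ENNReal.toReal_nonneg (by
      linarith [(abs_le.1 (abs_iterate_transOp_le (P := N.trans) hM t k)).1])
  rw [integral_add (integrable_law N p (measurable_comp_fst_real h) (fun z => hM z.1) t)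
    (integrable_const M), iterate_transOp_add_const hM,
    expect_add (K := |M|) _ (abs_iterate_transOp_le hM t) (fun _ => le_rfl), expect_const] at key
  simpa using key

theorem integral_stationary (ρ : ∀ s, Measure (X s)) [∀ s, IsProbabilityMeasure (ρ s)]
    {k : (Σ s, X s) → ℝ} (hk : Measurable k) {M : ℝ} (hM : ∀ z, |k z| ≤ M) (t : ℕ) :
    ∫ ω, k (ω t) ∂(N.law (stationaryPolicy ρ)) =
      expect N.init ((transOp N.trans)^[t] fun s => ∫ x, k ⟨s, x⟩ ∂(ρ s)) := by
  rw [← integral_state N (stationaryPolicy ρ) (abs_integral_action_le ρ hM)]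
  have h0 : ∀ z, 0 ≤ k z + M := fun z => by linarith [(abs_le.1 (hM z)).1]
  have hi : ∀ s, Integrable (fun x => k ⟨s, x⟩) (ρ s) := fun s =>
    Integrable.of_bound (hk.comp (measurable_sigma_mk s)).aestronglyMeasurable M
      (Eventually.of_forall fun _ => hM _)
  have hb := abs_integral_action_le ρ hM
  have h1 : ∀ s, 0 ≤ (∫ x, k ⟨s, x⟩ ∂(ρ s)) + M := fun s => by linarith [(abs_le.1 (hb s)).1]
  have hl : ∀ s, ∫⁻ x, ENNReal.ofReal (k ⟨s, x⟩ + M) ∂(ρ s) =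
      ENNReal.ofReal ((∫ x, k ⟨s, x⟩ ∂(ρ s)) + M) := fun s => by
    rw [← ofReal_integral_eq_lintegral_ofReal (f := fun x => k ⟨s, x⟩ + M)
      ((hi s).add (integrable_const M)) (Eventually.of_forall fun x => h0 _)]
    rw [integral_add (hi s) (integrable_const M)]
    simp
  have key : ∫ ω, (k (ω t) + M) ∂(N.law (stationaryPolicy ρ)) =
      ∫ ω, ((∫ x, k ⟨(ω t).1, x⟩ ∂(ρ (ω t).1)) + M) ∂(N.law (stationaryPolicy ρ)) := by
    rw [integral_eq_lintegral_of_nonneg_ae (Eventually.of_forall fun ω => h0 _)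
        ((hk.add_const M).comp (measurable_pi_apply t)).aestronglyMeasurable,
      integral_eq_lintegral_of_nonneg_ae (Eventually.of_forall fun ω => h1 _)
        ((measurable_comp_fst_real fun s => (∫ x, k ⟨s, x⟩ ∂(ρ s)) + M).comp
          (measurable_pi_apply t)).aestronglyMeasurable,
      lintegral_stationary N ρ (k := fun z => ENNReal.ofReal (k z + M))
        (hk.add_const M).ennreal_ofReal]
    simp only [hl]
  rw [integral_add (integrable_law N _ hk hM t) (integrable_const M), integral_add
    (integrable_law N _ (measurable_comp_fst_real fun s => ∫ x, k ⟨s, x⟩ ∂(ρ s))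
      (fun z => hb z.1) t) (integrable_const M)] at key
  exact add_right_cancel key

end Network

/-! ### The Lagrangian and weak duality. -/

/-- Minimization of a separable expectation can be carried out state by state. -/
theorem iInf_expect_le {𝒮 : Type*} {X : 𝒮 → Type*} [∀ s, Nonempty (X s)] (π : PMF 𝒮)
    {H : ∀ s, X s → ℝ} {B : ℝ} (hB : ∀ s x, |H s x| ≤ B) {k : 𝒮 → ℝ} {K : ℝ}
    (hK : ∀ s, |k s| ≤ K) (hk : ∀ s, ⨅ x, H s x ≤ k s) :
    ⨅ x : ∀ s, X s, expect π (fun s => H s (x s)) ≤ expect π k := by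
  refine le_of_forall_pos_le_add fun ε hε => ?_
  -- A selection `x` is unconstrained across states, so near-minimizers can be picked separately;
  -- the error `ε` integrates to `ε`.
  have hx : ∀ s, ∃ x, H s x < k s + ε := fun s =>
    exists_lt_of_ciInf_lt ((hk s).trans_lt (lt_add_of_pos_right _ hε))
  choose x hx using hx
  have hbdd : BddBelow (Set.range fun x : ∀ s, X s => expect π fun s => H s (x s)) := by
    refine ⟨-B, ?_⟩
    rintro _ ⟨y, rfl⟩
    exact (abs_le.1 (abs_expect_le π fun s => hB s (y s))).1
  refine (ciInf_le hbdd x).trans ?_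
  have h1 : ∀ s, |k s + ε| ≤ K + |ε| := fun s => (abs_add_le _ _).trans (add_le_add_left (hK s) _)
  refine (expect_mono π (fun s => hB s (x s)) h1 fun s => (hx s).le).trans_eq ?_
  rw [expect_add (K := |ε|) π hK (fun _ => le_rfl), expect_const]

namespace Network

section Lagrangian

variable {r : ℕ} {𝒮 : Type*} {X : 𝒮 → Type*}

/-- The summand of the dual function in state `s` under action `x`. -/
def lagrangian (N : Network r 𝒮 X) (V : ℝ) (γ : Fin r → ℝ) (s : 𝒮) (x : X s) : ℝ :=
  V * N.cost s x + ∑ j : Fin r, γ j * (N.arr j s x - N.srv j s x)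

variable {N : Network r 𝒮 X} {δ : ℝ}

theorem abs_drift_le (hδ : N.Bounded δ) (j : Fin r) (s : 𝒮) (x : X s) :
    |N.arr j s x - N.srv j s x| ≤ δ := by
  have h := (hδ s x).2 j
  exact abs_le.2 ⟨by linarith [h.1.1, h.2.2], by linarith [h.1.2, h.2.1]⟩

theorem abs_lagrangian_le (hδ : N.Bounded δ) (V : ℝ) (γ : Fin r → ℝ) (s : 𝒮) (x : X s) :
    |N.lagrangian V γ s x| ≤ |V| * δ + ∑ j : Fin r, |γ j| * δ := by
  refine (abs_add_le _ _).trans (add_le_add ?_ ((Finset.abs_sum_le_sum_abs _ _).trans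
    (Finset.sum_le_sum fun j _ => ?_)))
  · rw [abs_mul]
    exact mul_le_mul_of_nonneg_left (hδ s x).1 (abs_nonneg _)
  · rw [abs_mul]
    exact mul_le_mul_of_nonneg_left (abs_drift_le hδ j s x) (abs_nonneg _)

end Lagrangian

variable {r : ℕ} {𝒮 : Type*} [Countable 𝒮] {X : 𝒮 → Type*} [∀ s, MeasurableSpace (X s)]
  {N : Network r 𝒮 X} {p : Policy X} {δ : ℝ}

theorem integrable_backlog (hδ : N.Bounded δ) (harr : ∀ j s, Measurable (N.arr j s))
    (hsrv : ∀ j s, Measurable (N.srv j s)) (p : Policy X) (j : Fin r) (t : ℕ) :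
    Integrable (fun ω => N.backlog ω j t) (N.law p) :=
  Integrable.of_bound (measurable_backlog N harr hsrv j t).aestronglyMeasurable (t * δ)
    (Eventually.of_forall fun ω => by
      rw [Real.norm_of_nonneg (backlog_nonneg hδ ω j t)]
      exact backlog_le hδ ω j t)

/-- Under a stable policy the expected backlogs are bounded along a subsequence. -/
theorem Stable.exists_frequently_le (hp : N.Stable p) (hδ : N.Bounded δ)
    (harr : ∀ j s, Measurable (N.arr j s)) (hsrv : ∀ j s, Measurable (N.srv j s)) :
    ∃ C : ℝ, ∃ᶠ t : ℕ in atTop, ∀ j, ∫ ω, N.backlog ω j t ∂(N.law p) ≤ C := by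
  set e : ℕ → ℝ≥0∞ := fun τ => ∑ j : Fin r,
    ∫⁻ ω, ENNReal.ofReal (N.backlog ω j τ) ∂(N.law p) with he
  obtain ⟨c, hc, hctop⟩ := exists_between hp
  have hev := eventually_lt_of_limsup_lt hc
  obtain ⟨n₀, hn₀⟩ := eventually_atTop.1 hev
  refine ⟨(2 * c).toReal, frequently_atTop.2 fun T => ?_⟩
  have hex : ∃ t ≥ T, e t ≤ 2 * c := by
    by_contra! hcon
    -- At least half of the slots below `n` come at or after `T`; values above `2 c` on all of them
    -- would push the average up to `c`.
    set n := max n₀ (2 * T + 1) with hn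
    have hn1 : 2 * T + 1 ≤ n := le_max_right _ _
    have hnpos : (n : ℝ≥0∞) ≠ 0 := by
      rw [Ne, Nat.cast_eq_zero]; omega
    have h1 : ∑ τ ∈ Finset.range n, e τ < c * n :=
      (ENNReal.div_lt_iff (Or.inl hnpos) (Or.inl (ENNReal.natCast_ne_top n))).1
        (hn₀ n (le_max_left _ _))
    have h2 : ∑ τ ∈ Finset.Ico T n, 2 * c ≤ ∑ τ ∈ Finset.range n, e τ := by
      refine (Finset.sum_le_sum fun τ hτ => (hcon τ (Finset.mem_Ico.1 hτ).1).le).trans ?_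
      refine Finset.sum_le_sum_of_subset fun τ hτ => ?_
      exact Finset.mem_range.2 (Finset.mem_Ico.1 hτ).2
    have h3 : c * n ≤ ∑ τ ∈ Finset.Ico T n, 2 * c := by
      rw [Finset.sum_const, Nat.card_Ico, nsmul_eq_mul, mul_comm c, ← mul_assoc]
      refine mul_le_mul_left ?_ c
      exact_mod_cast (by omega : n ≤ (n - T) * 2)
    exact absurd (h3.trans h2) h1.not_ge
  obtain ⟨t, htT, ht⟩ := hex
  refine ⟨t, htT, fun j => ?_⟩
  have h1 : ∫⁻ ω, ENNReal.ofReal (N.backlog ω j t) ∂(N.law p) ≤ 2 * c :=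
    (Finset.single_le_sum (f := fun j : Fin r =>
      ∫⁻ ω, ENNReal.ofReal (N.backlog ω j t) ∂(N.law p)) (fun _ _ => zero_le)
      (Finset.mem_univ j)).trans ht
  rw [integral_eq_lintegral_of_nonneg_ae (Eventually.of_forall fun ω => backlog_nonneg hδ ω j t)
    (measurable_backlog N harr hsrv j t).aestronglyMeasurable]
  exact ENNReal.toReal_mono (ENNReal.mul_ne_top ENNReal.ofNat_ne_top hctop.ne) h1

theorem integrable_drift (hδ : N.Bounded δ) (harr : ∀ j s, Measurable (N.arr j s))
    (hsrv : ∀ j s, Measurable (N.srv j s)) (p : Policy X) (j : Fin r) (t : ℕ) :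
    Integrable (fun ω => N.arr j (ω t).1 (ω t).2 - N.srv j (ω t).1 (ω t).2) (N.law p) :=
  integrable_law N p (k := fun z => N.arr j z.1 z.2 - N.srv j z.1 z.2)
    (measurable_of_sigma fun s => (harr j s).sub (hsrv j s))
    (fun z => abs_drift_le hδ j z.1 z.2) t

/-- Dropping the truncation at zero only lowers the backlog, and the untruncated recursion
telescopes from `q_j(0) = 0`. -/
theorem sum_drift_le_backlog (hδ : N.Bounded δ) (harr : ∀ j s, Measurable (N.arr j s))
    (hsrv : ∀ j s, Measurable (N.srv j s)) (p : Policy X) (j : Fin r) (t : ℕ) :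
    ∑ τ ∈ Finset.range t, ∫ ω, (N.arr j (ω τ).1 (ω τ).2 - N.srv j (ω τ).1 (ω τ).2) ∂(N.law p) ≤
      ∫ ω, N.backlog ω j t ∂(N.law p) := by
  induction t with
  | zero => simp [backlog]
  | succ t ih =>
    rw [Finset.sum_range_succ]
    refine (add_le_add_left ih _).trans ?_
    rw [← integral_add (integrable_backlog hδ harr hsrv p j t)
      (integrable_drift hδ harr hsrv p j t)]
    refine integral_mono ((integrable_backlog hδ harr hsrv p j t).add
      (integrable_drift hδ harr hsrv p j t)) (integrable_backlog hδ harr hsrv p j (t + 1))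
      fun ω => ?_
    have := le_backlog_succ (N := N) ω j t
    linarith

theorem abs_cost_average_le (hδ : N.Bounded δ) (p : Policy X) (hδ0 : 0 ≤ δ) (t : ℕ) :
    |(∑ τ ∈ Finset.range t, ∫ ω, N.cost (ω τ).1 (ω τ).2 ∂(N.law p)) / (t : ℝ)| ≤ δ := by
  rw [abs_div, Nat.abs_cast]
  refine div_le_of_le_mul₀ (Nat.cast_nonneg t) hδ0 ?_
  refine (Finset.abs_sum_le_sum_abs _ _).trans ((Finset.sum_le_sum fun τ _ => ?_).trans_eq
    (show ∑ _τ ∈ Finset.range t, δ = δ * t by simp [mul_comm]))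
  have h := norm_integral_le_of_norm_le_const (μ := N.law p)
    (f := fun ω => N.cost (ω τ).1 (ω τ).2) (C := δ) (Eventually.of_forall fun ω => (hδ _ _).1)
  simpa using h

/-- Weak duality: the dual function bounds the cost of every stable policy from below. -/
theorem Stable.dual_le (hp : N.Stable p) (hδ : N.Bounded δ) [∀ s, Nonempty (X s)]
    (hcost : ∀ s, Measurable (N.cost s))
    (harr : ∀ j s, Measurable (N.arr j s)) (hsrv : ∀ j s, Measurable (N.srv j s))
    (hirr : Irreducible N.trans) {π : PMF 𝒮} (hπ : IsStationary N.trans π) {V : ℝ} (hV : 0 < V)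
    {γ : Fin r → ℝ} (hγ : 0 ≤ γ) : N.dual π V γ ≤ V * N.avgCost p := by
  obtain ⟨s₀, -⟩ := N.init.support_nonempty
  obtain ⟨x₀⟩ := (inferInstance : Nonempty (X s₀))
  have hδ0 : 0 ≤ δ := (abs_nonneg _).trans (hδ s₀ x₀).1
  set B := |V| * δ + ∑ j : Fin r, |γ j| * δ
  have hB : ∀ s x, |N.lagrangian V γ s x| ≤ B := abs_lagrangian_le hδ V γ
  have hbb : ∀ s, BddBelow (Set.range (N.lagrangian V γ s)) := fun s =>
    ⟨-B, by rintro _ ⟨x, rfl⟩; exact (abs_le.1 (hB s x)).1⟩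
  set h : 𝒮 → ℝ := fun s => ⨅ x, N.lagrangian V γ s x with hh
  have hhle : ∀ s x, h s ≤ N.lagrangian V γ s x := fun s x => ciInf_le (hbb s) x
  have hhB : ∀ s, |h s| ≤ B := fun s => abs_le.2
    ⟨le_ciInf fun x => (abs_le.1 (hB s x)).1,
      (hhle s (Classical.arbitrary _)).trans (abs_le.1 (hB s _)).2⟩
  have hdual : N.dual π V γ ≤ expect π h := iInf_expect_le π hB hhB fun s => le_rfl
  refine hdual.trans ?_
  set a : ℕ → ℝ := fun t =>
    (∑ τ ∈ Finset.range t, ∫ ω, N.cost (ω τ).1 (ω τ).2 ∂(N.law p)) / (t : ℝ) with ha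
  obtain ⟨C, hC⟩ := hp.exists_frequently_le hδ harr hsrv
  have hmc : Measurable fun z : Σ s, X s => N.cost z.1 z.2 := measurable_of_sigma hcost
  -- The pointwise bound by `h` holds for any action, however it depends on the history.
  have hslot : ∀ τ, expect N.init ((transOp N.trans)^[τ] h) ≤
      V * ∫ ω, N.cost (ω τ).1 (ω τ).2 ∂(N.law p) + ∑ j, γ j *
        ∫ ω, (N.arr j (ω τ).1 (ω τ).2 - N.srv j (ω τ).1 (ω τ).2) ∂(N.law p) := by
    intro τ
    have hi1 := integrable_law N p hmc (fun z => (hδ z.1 z.2).1) τ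
    have hi2 := fun j => integrable_drift hδ harr hsrv p j τ
    rw [← integral_state N p hhB, ← integral_const_mul]
    simp only [← integral_const_mul]
    rw [← integral_finsetSum _ fun j _ => (hi2 j).const_mul (γ j),
      ← integral_add (hi1.const_mul V) (integrable_finsetSum _ fun j _ => (hi2 j).const_mul (γ j))]
    refine integral_mono (integrable_law N p (measurable_comp_fst_real h) (fun z => hhB z.1) τ)
      ((hi1.const_mul V).add (integrable_finsetSum _ fun j _ => (hi2 j).const_mul (γ j)))
      fun ω => hhle _ _
  have hsum : ∀ t : ℕ, ∑ τ ∈ Finset.range t, expect N.init ((transOp N.trans)^[τ] h) ≤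
      V * ∑ τ ∈ Finset.range t, ∫ ω, N.cost (ω τ).1 (ω τ).2 ∂(N.law p) +
        ∑ j, γ j * ∫ ω, N.backlog ω j t ∂(N.law p) := by
    intro t
    refine (Finset.sum_le_sum fun τ _ => hslot τ).trans ?_
    rw [Finset.sum_add_distrib, ← Finset.mul_sum, Finset.sum_comm]
    simp only [← Finset.mul_sum]
    exact add_le_add_right (Finset.sum_le_sum fun j _ =>
      mul_le_mul_of_nonneg_left (sum_drift_le_backlog hδ harr hsrv p j t) (hγ j)) _
  have hlim : Tendsto (fun t : ℕ =>
      (∑ τ ∈ Finset.range t, expect N.init ((transOp N.trans)^[τ] h)) / (t : ℝ) -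
        (∑ j, γ j * C) / (t : ℝ)) atTop (nhds (expect π h)) := by
    simpa using (tendsto_expect_cesaro hirr hπ hhB N.init).sub
      (tendsto_const_nhds.div_atTop tendsto_natCast_atTop_atTop)
  rw [mul_comm, ← div_le_iff₀ hV]
  refine le_of_forall_lt fun y hy => ?_
  obtain ⟨y', hy1, hy2⟩ := exists_between hy
  refine hy1.trans_le ?_
  rw [lt_div_iff₀ hV] at hy2
  -- A limsup is bounded below by values at infinitely many times, which is exactly where stability
  -- controls the backlogs.
  refine le_limsup_of_frequently_le ?_ (isBoundedUnder_of ⟨δ, fun t =>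
    (abs_le.1 (abs_cost_average_le hδ p hδ0 t)).2⟩)
  refine (hC.and_eventually ((hlim.eventually_const_lt hy2).and
    (eventually_ge_atTop 1))).mono ?_
  rintro t ⟨h1, h2, h3⟩
  have ht : (0 : ℝ) < t := by exact_mod_cast h3
  have h4 : ∑ j, γ j * ∫ ω, N.backlog ω j t ∂(N.law p) ≤ ∑ j, γ j * C :=
    Finset.sum_le_sum fun j _ => mul_le_mul_of_nonneg_left (h1 j) (hγ j)
  rw [← sub_div, lt_div_iff₀ ht] at h2
  rw [le_div_iff₀ ht]
  have h5 := hsum t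
  refine le_of_mul_le_mul_left ?_ hV
  linarith

end Network

/-! ### One-slot inequalities for backlogs weighted by functions of the state. -/

namespace Network

section Static

variable {r : ℕ} {𝒮 : Type*} {X : 𝒮 → Type*} {N : Network r 𝒮 X} {δ : ℝ}

theorem dependsOn_backlog (j : Fin r) (t : ℕ) :
    DependsOn (fun ω => ENNReal.ofReal (N.backlog ω j (t + 1))) (Set.Iic t) := fun ω ω' h => by
  have := backlog_congr N j (t := t + 1) (ω := ω) (ω' := ω') fun m hm => h m (Nat.lt_succ_iff.1 hm)
  simp only [this]

theorem backlog_le_succ_add (hδ : N.Bounded δ) (ω : ℕ → Σ s, X s) (j : Fin r) (t : ℕ) :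
    N.backlog ω j t ≤ N.backlog ω j (t + 1) + δ := by
  have h := (hδ (ω t).1 (ω t).2).2 j
  linarith [le_backlog_succ (N := N) ω j t, h.1.1, h.2.2]

variable [∀ s, MeasurableSpace (X s)]

theorem measurable_state (f : 𝒮 → ℝ≥0∞) (t : ℕ) :
    Measurable fun ω : ℕ → Σ s, X s => f (ω t).1 :=
  (measurable_comp_fst f).comp (measurable_pi_apply t)

theorem measurable_backlog_ofReal (harr : ∀ j s, Measurable (N.arr j s))
    (hsrv : ∀ j s, Measurable (N.srv j s)) (j : Fin r) (t : ℕ) :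
    Measurable fun ω => ENNReal.ofReal (N.backlog ω j t) :=
  (measurable_backlog N harr hsrv j t).ennreal_ofReal

theorem measurable_backlog_mul_state (harr : ∀ j s, Measurable (N.arr j s))
    (hsrv : ∀ j s, Measurable (N.srv j s)) (j : Fin r) (t : ℕ) (f : 𝒮 → ℝ≥0∞) :
    Measurable fun ω => ENNReal.ofReal (N.backlog ω j t) * f (ω t).1 :=
  (measurable_backlog_ofReal harr hsrv j t).mul (measurable_state f t)

/-- The mean drift of queue `j` in state `s` when actions are drawn from `ρ s`. -/
noncomputable def meanDrift (N : Network r 𝒮 X) (ρ : ∀ s, Measure (X s)) (j : Fin r) (s : 𝒮) : ℝ :=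
  ∫ x, (N.arr j s x - N.srv j s x) ∂(ρ s)

/-- The mean cost in state `s` when actions are drawn from `ρ s`. -/
noncomputable def meanCost (N : Network r 𝒮 X) (ρ : ∀ s, Measure (X s)) (s : 𝒮) : ℝ :=
  ∫ x, N.cost s x ∂(ρ s)

variable (ρ : ∀ s, Measure (X s)) [∀ s, IsProbabilityMeasure (ρ s)]

theorem abs_meanDrift_le (hδ : N.Bounded δ) (j : Fin r) (s : 𝒮) : |N.meanDrift ρ j s| ≤ δ :=
  abs_integral_action_le ρ (k := fun z => N.arr j z.1 z.2 - N.srv j z.1 z.2)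
    (fun z => abs_drift_le hδ j z.1 z.2) s

theorem abs_meanCost_le (hδ : N.Bounded δ) (s : 𝒮) : |N.meanCost ρ s| ≤ δ :=
  abs_integral_action_le ρ (k := fun z => N.cost z.1 z.2) (fun z => (hδ z.1 z.2).1) s

theorem integrable_drift_action (hδ : N.Bounded δ) (harr : ∀ j s, Measurable (N.arr j s))
    (hsrv : ∀ j s, Measurable (N.srv j s)) (j : Fin r) (s : 𝒮) :
    Integrable (fun x => N.arr j s x - N.srv j s x) (ρ s) :=
  Integrable.of_bound ((harr j s).sub (hsrv j s)).aestronglyMeasurable δ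
    (Eventually.of_forall fun x => abs_drift_le hδ j s x)

theorem integrable_cost_action (hδ : N.Bounded δ) (hcost : ∀ s, Measurable (N.cost s)) (s : 𝒮) :
    Integrable (N.cost s) (ρ s) :=
  Integrable.of_bound (hcost s).aestronglyMeasurable δ (Eventually.of_forall fun x => (hδ s x).1)

theorem lintegral_drift_add (hδ : N.Bounded δ) (harr : ∀ j s, Measurable (N.arr j s))
    (hsrv : ∀ j s, Measurable (N.srv j s)) (j : Fin r) (s : 𝒮) :
    ∫⁻ x, ENNReal.ofReal (N.arr j s x - N.srv j s x + δ) ∂(ρ s) =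
      ENNReal.ofReal (N.meanDrift ρ j s + δ) := by
  have hi := integrable_drift_action ρ hδ harr hsrv j s
  rw [← ofReal_integral_eq_lintegral_ofReal (f := fun x => N.arr j s x - N.srv j s x + δ)
    (hi.add (integrable_const δ))
    (Eventually.of_forall fun x => by
      have := (abs_le.1 (abs_drift_le hδ j s x)).1
      change (0 : ℝ) ≤ N.arr j s x - N.srv j s x + δ
      linarith)]
  rw [integral_add hi (integrable_const δ)]
  simp [meanDrift]

end Static

variable {r : ℕ} {𝒮 : Type*} [Countable 𝒮] {X : 𝒮 → Type*} [∀ s, MeasurableSpace (X s)]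
  {N : Network r 𝒮 X} {δ : ℝ}

theorem lintegral_backlog_mul_ne_top (hδ : N.Bounded δ) (p : Policy X) (j : Fin r) (t : ℕ)
    {f : 𝒮 → ℝ≥0∞} (hf : lmean N.trans N.init f t ≠ ⊤) :
    ∫⁻ ω, ENNReal.ofReal (N.backlog ω j t) * f (ω t).1 ∂(N.law p) ≠ ⊤ := by
  refine ne_top_of_le_ne_top (ENNReal.mul_ne_top ENNReal.ofReal_ne_top hf)
    (b := ENNReal.ofReal (t * δ) * lmean N.trans N.init f t) ?_
  rw [← lintegral_state N p, ← lintegral_const_mul _ (measurable_state f t)]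
  exact lintegral_mono fun ω => mul_le_mul_left (ENNReal.ofReal_le_ofReal (backlog_le hδ ω j t)) _

/-- The backlog at `t + 1` is determined by the slots up to `t`, so the next state can be averaged
out. -/
theorem lintegral_backlog_succ_mul (harr : ∀ j s, Measurable (N.arr j s))
    (hsrv : ∀ j s, Measurable (N.srv j s)) (p : Policy X) (j : Fin r) (t : ℕ) (f : 𝒮 → ℝ≥0∞) :
    ∫⁻ ω, ENNReal.ofReal (N.backlog ω j (t + 1)) * f (ω (t + 1)).1 ∂(N.law p) =
      ∫⁻ ω, ENNReal.ofReal (N.backlog ω j (t + 1)) * ltransOp N.trans f (ω t).1 ∂(N.law p) :=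
  lintegral_mul_state_succ N p (measurable_backlog_ofReal harr hsrv j (t + 1))
    (dependsOn_backlog j t) f

theorem lintegral_add_const_mul_state (p : Policy X) {F : (ℕ → Σ s, X s) → ℝ≥0∞}
    (hF : Measurable F) (c : ℝ≥0∞) (f : 𝒮 → ℝ≥0∞) (t : ℕ) :
    ∫⁻ ω, (F ω + c) * f (ω t).1 ∂(N.law p) =
      ∫⁻ ω, F ω * f (ω t).1 ∂(N.law p) + c * lmean N.trans N.init f t := by
  have hm : Measurable fun ω : ℕ → Σ s, X s => f (ω t).1 := measurable_state f t
  have hFm : Measurable fun ω => F ω * f (ω t).1 := hF.mul hm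
  simp only [add_mul]
  rw [lintegral_add_left hFm, lintegral_const_mul _ hm, lintegral_state]

/-- A backlog moves by at most `δ` per slot, in either direction. This bound and its reverse
`lintegral_backlog_le_succ` are both needed because the corrector is a difference of two nonnegative
functions. -/
theorem lintegral_backlog_succ_le (hδ : N.Bounded δ) (hδ0 : 0 ≤ δ)
    (harr : ∀ j s, Measurable (N.arr j s)) (hsrv : ∀ j s, Measurable (N.srv j s)) (p : Policy X)
    (j : Fin r) (t : ℕ) (f : 𝒮 → ℝ≥0∞) :
    ∫⁻ ω, ENNReal.ofReal (N.backlog ω j (t + 1)) * f (ω (t + 1)).1 ∂(N.law p) ≤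
      ∫⁻ ω, ENNReal.ofReal (N.backlog ω j t) * ltransOp N.trans f (ω t).1 ∂(N.law p) +
        ENNReal.ofReal δ * lmean N.trans N.init f (t + 1) := by
  rw [lintegral_backlog_succ_mul harr hsrv, ← lmean_ltransOp, ← lintegral_add_const_mul_state p
    (measurable_backlog_ofReal harr hsrv j t)]
  refine lintegral_mono fun ω => mul_le_mul_left ?_ _
  rw [← ENNReal.ofReal_add (backlog_nonneg hδ ω j t) hδ0]
  exact ENNReal.ofReal_le_ofReal (backlog_succ_le hδ ω j t)

theorem lintegral_backlog_le_succ (hδ : N.Bounded δ) (hδ0 : 0 ≤ δ)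
    (harr : ∀ j s, Measurable (N.arr j s)) (hsrv : ∀ j s, Measurable (N.srv j s)) (p : Policy X)
    (j : Fin r) (t : ℕ) (f : 𝒮 → ℝ≥0∞) :
    ∫⁻ ω, ENNReal.ofReal (N.backlog ω j t) * ltransOp N.trans f (ω t).1 ∂(N.law p) ≤
      ∫⁻ ω, ENNReal.ofReal (N.backlog ω j (t + 1)) * f (ω (t + 1)).1 ∂(N.law p) +
        ENNReal.ofReal δ * lmean N.trans N.init f (t + 1) := by
  rw [lintegral_backlog_succ_mul harr hsrv, ← lmean_ltransOp, ← lintegral_add_const_mul_state p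
    (measurable_backlog_ofReal harr hsrv j (t + 1))]
  refine lintegral_mono fun ω => mul_le_mul_left ?_ _
  rw [← ENNReal.ofReal_add (backlog_nonneg hδ ω j (t + 1)) hδ0]
  exact ENNReal.ofReal_le_ofReal (backlog_le_succ_add hδ ω j t)

/-- The backlog weighted by the identity `passageSum_add_eq`. -/
theorem lintegral_backlog_passageSum (harr : ∀ j s, Measurable (N.arr j s))
    (hsrv : ∀ j s, Measurable (N.srv j s)) (p : Policy X) (j : Fin r) (t : ℕ) (i : 𝒮)
    (g : 𝒮 → ℝ≥0∞) :
    ∫⁻ ω, ENNReal.ofReal (N.backlog ω j t) * passageSum N.trans i g (ω t).1 ∂(N.law p) +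
        passageSum N.trans i g i *
          ∫⁻ ω, ENNReal.ofReal (N.backlog ω j t) * N.trans (ω t).1 i ∂(N.law p) =
      ∫⁻ ω, ENNReal.ofReal (N.backlog ω j t) * g (ω t).1 ∂(N.law p) +
        ∫⁻ ω, ENNReal.ofReal (N.backlog ω j t) *
          ltransOp N.trans (passageSum N.trans i g) (ω t).1 ∂(N.law p) := by
  have hm := measurable_backlog_mul_state harr hsrv j t
  rw [← lintegral_const_mul _ (hm fun s => N.trans s i),
    ← lintegral_add_left (hm _), ← lintegral_add_left (hm _)]
  refine lintegral_congr fun ω => ?_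
  rw [← mul_add, ← passageSum_add_eq]
  ring

variable (ρ : ∀ s, Measure (X s)) [∀ s, IsProbabilityMeasure (ρ s)]

theorem lintegral_backlog_mul_action (harr : ∀ j s, Measurable (N.arr j s))
    (hsrv : ∀ j s, Measurable (N.srv j s)) (j : Fin r) (t : ℕ) {k : (Σ s, X s) → ℝ≥0∞}
    (hk : Measurable k) :
    ∫⁻ ω, ENNReal.ofReal (N.backlog ω j t) * k (ω t) ∂(N.law (stationaryPolicy ρ)) =
      ∫⁻ ω, ENNReal.ofReal (N.backlog ω j t) * (∫⁻ x, k ⟨(ω t).1, x⟩ ∂(ρ (ω t).1))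
        ∂(N.law (stationaryPolicy ρ)) := by
  cases t with
  | zero => simp [backlog]
  | succ t =>
    exact lintegral_mul_stationary_succ N ρ (n := t)
      (measurable_backlog_ofReal harr hsrv j (t + 1)) (dependsOn_backlog j t) hk

/-- The drift is shifted by `δ` to stay nonnegative in `ℝ≥0∞`; the term `2 δ E[q]` on the left
compensates. -/
theorem lintegral_backlog_sq_succ_le (hδ : N.Bounded δ) (hδ0 : 0 ≤ δ)
    (harr : ∀ j s, Measurable (N.arr j s)) (hsrv : ∀ j s, Measurable (N.srv j s)) (j : Fin r)
    (t : ℕ) :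
    ∫⁻ ω, ENNReal.ofReal (N.backlog ω j (t + 1) ^ 2) ∂(N.law (stationaryPolicy ρ)) +
        ENNReal.ofReal (2 * δ) *
          ∫⁻ ω, ENNReal.ofReal (N.backlog ω j t) ∂(N.law (stationaryPolicy ρ)) ≤
      ∫⁻ ω, ENNReal.ofReal (N.backlog ω j t ^ 2) ∂(N.law (stationaryPolicy ρ)) +
        ENNReal.ofReal (2 * δ ^ 2) +
        2 * ∫⁻ ω, ENNReal.ofReal (N.backlog ω j t) *
          ENNReal.ofReal (N.meanDrift ρ j (ω t).1 + δ) ∂(N.law (stationaryPolicy ρ)) := by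
  have hq := measurable_backlog_ofReal harr hsrv j
  have hq2 : ∀ t, Measurable fun ω => ENNReal.ofReal (N.backlog ω j t ^ 2) := fun t =>
    ((measurable_backlog N harr hsrv j t).pow_const 2).ennreal_ofReal
  have hq2c : ∀ t, Measurable fun ω =>
      ENNReal.ofReal (N.backlog ω j t ^ 2) + ENNReal.ofReal (2 * δ ^ 2) := fun t =>
    (hq2 t).add measurable_const
  have hk : Measurable fun z : Σ s, X s =>
      ENNReal.ofReal (N.arr j z.1 z.2 - N.srv j z.1 z.2 + δ) :=
    measurable_of_sigma fun s => (((harr j s).sub (hsrv j s)).add_const δ).ennreal_ofReal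
  have hkt : Measurable fun ω : ℕ → Σ s, X s => ENNReal.ofReal (N.backlog ω j t) *
      ENNReal.ofReal (N.arr j (ω t).1 (ω t).2 - N.srv j (ω t).1 (ω t).2 + δ) :=
    (hq t).mul (hk.comp (measurable_pi_apply t))
  have h1 := lintegral_backlog_mul_action ρ harr hsrv j t hk
  simp only [lintegral_drift_add ρ hδ harr hsrv] at h1
  have hconst : ENNReal.ofReal (2 * δ ^ 2) =
      ∫⁻ _ω, ENNReal.ofReal (2 * δ ^ 2) ∂(N.law (stationaryPolicy ρ)) := by simp
  rw [← h1, ← lintegral_const_mul _ (hq t), ← lintegral_add_left (hq2 _),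
    ← lintegral_const_mul _ hkt, hconst, ← lintegral_add_left (hq2 _),
    ← lintegral_add_left (hq2c t)]
  refine lintegral_mono fun ω => ?_
  have hb := backlog_nonneg hδ ω j t
  have hd : 0 ≤ N.arr j (ω t).1 (ω t).2 - N.srv j (ω t).1 (ω t).2 + δ := by
    linarith [(abs_le.1 (abs_drift_le hδ j (ω t).1 (ω t).2)).1]
  have h2 : (2 : ℝ≥0∞) = ENNReal.ofReal 2 := by simp
  beta_reduce
  rw [h2, ← ENNReal.ofReal_mul (by positivity), ← ENNReal.ofReal_mul hb,
    ← ENNReal.ofReal_mul zero_le_two, ← ENNReal.ofReal_add (by positivity) (by positivity),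
    ← ENNReal.ofReal_add (by positivity) (by positivity),
    ← ENNReal.ofReal_add (by positivity) (by positivity)]
  refine ENNReal.ofReal_le_ofReal ?_
  linarith [backlog_succ_sq_le hδ ω j t]

/-- Pointwise, `2 a q w` is at most `q²` when `2 a w ≤ q`, and otherwise at most `4 a² w² ≤ 8 a² W`.
-/
theorem lintegral_backlog_mul_passageMean_le (hδ : N.Bounded δ)
    (harr : ∀ j s, Measurable (N.arr j s)) (hsrv : ∀ j s, Measurable (N.srv j s)) (p : Policy X)
    (j : Fin r) (t : ℕ) {i : 𝒮} (hW : ∀ s, passageQuad N.trans i s ≠ ⊤) (a : ℝ≥0∞) :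
    2 * a * ∫⁻ ω, ENNReal.ofReal (N.backlog ω j t) * passageMean N.trans i (ω t).1 ∂(N.law p) ≤
      ∫⁻ ω, ENNReal.ofReal (N.backlog ω j t ^ 2) ∂(N.law p) +
        8 * (a * a) * lmean N.trans N.init (passageQuad N.trans i) t := by
  rw [← lintegral_state N p,
    ← lintegral_const_mul _ (measurable_backlog_mul_state harr hsrv j t _),
    ← lintegral_const_mul _ (measurable_state _ t), ← lintegral_add_left
      ((measurable_backlog N harr hsrv j t).pow_const 2).ennreal_ofReal]
  refine lintegral_mono fun ω => ?_
  beta_reduce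
  rw [sq, ENNReal.ofReal_mul (backlog_nonneg hδ ω j t)]
  have hw := passageMean_sq_le (hW (ω t).1)
  generalize ENNReal.ofReal (N.backlog ω j t) = q
  generalize passageMean N.trans i (ω t).1 = w at *
  generalize passageQuad N.trans i (ω t).1 = W at *
  rcases le_total (2 * a * w) q with h | h
  · calc 2 * a * (q * w) = q * (2 * a * w) := by ring
      _ ≤ q * q := by gcongr
      _ ≤ _ := le_self_add
  · calc 2 * a * (q * w) = q * (2 * a * w) := by ring
      _ ≤ (2 * a * w) * (2 * a * w) := by gcongr
      _ = 4 * (a * a) * (w * w) := by ring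
      _ ≤ 4 * (a * a) * (2 * W) := by gcongr
      _ = 8 * (a * a) * W := by ring
      _ ≤ _ := le_add_self

end Network

/-! ### Stability of randomized stationary policies with negative mean drift. -/

namespace Network

variable {r : ℕ} {𝒮 : Type*} [Countable 𝒮] {X : 𝒮 → Type*} [∀ s, MeasurableSpace (X s)]
  {N : Network r 𝒮 X} {δ : ℝ} (ρ : ∀ s, Measure (X s)) [∀ s, IsProbabilityMeasure (ρ s)]

/-- Negative mean drift bounds the accumulated expected backlog linearly in time. -/
theorem exists_sum_backlog_le (hδ : N.Bounded δ) (hδ0 : 0 ≤ δ)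
    (harr : ∀ j s, Measurable (N.arr j s)) (hsrv : ∀ j s, Measurable (N.srv j s))
    (hirr : Irreducible N.trans) {π : PMF 𝒮} (hπ : IsStationary N.trans π) {i : 𝒮}
    (hW : ∀ s, passageQuad N.trans i s ≠ ⊤) (hinit : lexpect N.init (passageQuad N.trans i) ≠ ⊤)
    (j : Fin r) (hdrift : expect π (N.meanDrift ρ j) < 0) :
    ∃ K : ℝ, ∀ t : ℕ, ∑ τ ∈ Finset.range t,
      ∫⁻ ω, ENNReal.ofReal (N.backlog ω j τ) ∂(N.law (stationaryPolicy ρ)) ≤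
        ENNReal.ofReal (K * (t + 1)) := by
  set p := stationaryPolicy ρ with hp
  set μ := N.law p with hμ
  -- The shifted drift takes values in `[0, 2 δ]`; with `a` its `π`-mean, `η = δ - a` below is minus
  -- the mean drift.
  set h : 𝒮 → ℝ := fun s => N.meanDrift ρ j s + δ with hh
  have hd := abs_meanDrift_le ρ hδ j
  have h0 : ∀ s, 0 ≤ h s := fun s => by linarith [(abs_le.1 (hd s)).1]
  have h2 : ∀ s, h s ≤ 2 * δ := fun s => by linarith [(abs_le.1 (hd s)).2]
  have hM : ∀ s, |h s| ≤ 2 * δ := fun s => by rw [abs_of_nonneg (h0 s)]; exact h2 s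
  set g : 𝒮 → ℝ≥0∞ := fun s => ENNReal.ofReal (h s) with hg
  set a := expect π h with ha
  have hae : a = expect π (N.meanDrift ρ j) + δ := by
    rw [ha, hh, expect_add (K := |δ|) π hd (fun _ => le_rfl), expect_const]
  have ha0 : 0 ≤ a := tsum_nonneg fun s => mul_nonneg ENNReal.toReal_nonneg (h0 s)
  have haδ : a ≤ δ := by linarith
  set η := δ - a with hη
  have hη0 : 0 < η := by linarith
  have hgM : ∀ s, g s ≤ ENNReal.ofReal (2 * δ) := fun s => ENNReal.ofReal_le_ofReal (h2 s)
  have hwi : passageMean N.trans i i ≠ ⊤ := ne_top_of_le_ne_top (hW i) (passageMean_le_quad i)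
  have hΦi : passageSum N.trans i g i ≠ ⊤ := ne_top_of_le_ne_top
    (ENNReal.mul_ne_top ENNReal.ofReal_ne_top hwi) (passageSum_le hgM i)
  -- Kac's formula for `h` and for `1` makes the defects at `i` of the two Poisson equations
  -- proportional, so they cancel in the combination with coefficient `a`.
  have hkac : (passageSum N.trans i g i).toReal = a * (passageMean N.trans i i).toReal := by
    have k1 := passageSum_self_mul hirr hπ hW hinit h0 hM
    have k2 := passageSum_self_mul hirr hπ hW hinit (h := fun _ => 1) (M := 1)
      (fun _ => zero_le_one) (fun _ => by simp)
    rw [expect_const] at k2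
    simp only [ENNReal.ofReal_one] at k2
    change (passageMean N.trans i i).toReal * _ = 1 at k2
    rw [← hg] at k1
    have hpos := stationary_pos hirr hπ i
    refine mul_right_cancel₀ hpos.ne' ?_
    rw [k1, mul_assoc, k2, mul_one]
  have hwt : ∀ t, lmean N.trans N.init (passageMean N.trans i) t ≠ ⊤ :=
    lmean_passageMean_ne_top hW hinit
  have hΦw : ∀ t, lmean N.trans N.init (passageSum N.trans i g) t ≤
      ENNReal.ofReal (2 * δ) * lmean N.trans N.init (passageMean N.trans i) t := fun t => by
    rw [← lmean_const_mul]
    exact lmean_mono _ (passageSum_le hgM) t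
  have hΦt : ∀ t, lmean N.trans N.init (passageSum N.trans i g) t ≠ ⊤ := fun t =>
    ne_top_of_le_ne_top (ENNReal.mul_ne_top ENNReal.ofReal_ne_top (hwt t)) (hΦw t)
  have hQt : ∀ t, lmean N.trans N.init (passageQuad N.trans i) t ≠ ⊤ :=
    lmean_passageQuad_ne_top hW hinit
  have hgt : ∀ t, lmean N.trans N.init g t ≠ ⊤ := fun t =>
    ne_top_of_le_ne_top ENNReal.ofReal_ne_top
      ((lmean_mono _ hgM t).trans_eq (lmean_const _ _ t))
  have hpt : ∀ t, lmean N.trans N.init (fun s => N.trans s i) t ≠ ⊤ := fun t =>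
    ne_top_of_le_ne_top ENNReal.one_ne_top
      ((lmean_mono _ (fun s => (N.trans s).coe_le_one i) t).trans_eq (lmean_const _ _ t))
  set E : ℕ → (𝒮 → ℝ≥0∞) → ℝ≥0∞ := fun t f =>
    ∫⁻ ω, ENNReal.ofReal (N.backlog ω j t) * f (ω t).1 ∂μ with hE
  set z : ℕ → ℝ≥0∞ := fun t => ∫⁻ ω, ENNReal.ofReal (N.backlog ω j t ^ 2) ∂μ with hz
  have hfin : ∀ t f, lmean N.trans N.init f t ≠ ⊤ → E t f ≠ ⊤ := fun t f hf =>
    lintegral_backlog_mul_ne_top hδ p j t hf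
  have hEone : ∀ t, E t 1 = ∫⁻ ω, ENNReal.ofReal (N.backlog ω j t) ∂μ := fun t => by
    simp only [hE, Pi.one_apply, mul_one]
  have hone : ∀ t, lmean N.trans N.init 1 t ≠ ⊤ := fun t => by
    rw [show (1 : 𝒮 → ℝ≥0∞) = fun _ => 1 from rfl, lmean_const]
    exact ENNReal.one_ne_top
  have hzt : ∀ t, z t ≠ ⊤ := fun t => by
    refine ne_top_of_le_ne_top (ENNReal.ofReal_ne_top (r := (t * δ) ^ 2)) ?_
    refine (lintegral_mono (g := fun _ => ENNReal.ofReal ((t * δ) ^ 2)) fun ω =>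
      ENNReal.ofReal_le_ofReal ?_).trans_eq (by simp)
    exact pow_le_pow_left₀ (backlog_nonneg hδ ω j t) (backlog_le hδ ω j t) 2
  have hLΦ : ∀ t, lmean N.trans N.init (ltransOp N.trans (passageSum N.trans i g)) t ≠ ⊤ :=
    fun t => by rw [lmean_ltransOp]; exact hΦt (t + 1)
  have hLw : ∀ t, lmean N.trans N.init (ltransOp N.trans (passageMean N.trans i)) t ≠ ⊤ :=
    fun t => by rw [lmean_ltransOp]; exact hwt (t + 1)
  set m : ℕ → ℝ := fun t => (lmean N.trans N.init (passageMean N.trans i) t).toReal with hm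
  set W : ℕ → ℝ := fun t => (lmean N.trans N.init (passageQuad N.trans i) t).toReal with hWdef
  have hm0 : ∀ t, 0 ≤ m t := fun t => ENNReal.toReal_nonneg
  -- Half the squared backlog plus the backlog times the corrector `Φ - a w`, which solves the
  -- Poisson equation for `h - a`.
  set L : ℕ → ℝ := fun t => (z t).toReal / 2 + (E t (passageSum N.trans i g)).toReal -
    a * (E t (passageMean N.trans i)).toReal with hL
  -- The corrector replaces the state-dependent drift by its mean `-η`. Of the error `3 δ² m`, the
  -- part `2 δ²` comes from `Φ ≤ 2 δ w` and `δ²` from `a ≤ δ`.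
  have hstep : ∀ t, L (t + 1) + η * (E t 1).toReal ≤ L t + δ ^ 2 + 3 * δ ^ 2 * m (t + 1) := by
    intro t
    have e1 : (E t (passageSum N.trans i g) + passageSum N.trans i g i *
        E t (fun s => N.trans s i)).toReal =
        (E t g + E t (ltransOp N.trans (passageSum N.trans i g))).toReal :=
      congrArg ENNReal.toReal (lintegral_backlog_passageSum harr hsrv p j t i g)
    rw [ENNReal.toReal_add (hfin t _ (hΦt t)) (ENNReal.mul_ne_top hΦi (hfin t _ (hpt t))),
      ENNReal.toReal_add (hfin t _ (hgt t)) (hfin t _ (hLΦ t)), ENNReal.toReal_mul, hkac] at e1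
    have e2 : (E t (passageMean N.trans i) + passageMean N.trans i i *
        E t (fun s => N.trans s i)).toReal =
        (E t 1 + E t (ltransOp N.trans (passageMean N.trans i))).toReal :=
      congrArg ENNReal.toReal (lintegral_backlog_passageSum harr hsrv p j t i 1)
    rw [ENNReal.toReal_add (hfin t _ (hwt t)) (ENNReal.mul_ne_top hwi (hfin t _ (hpt t))),
      ENNReal.toReal_add (hfin t _ (hone t)) (hfin t _ (hLw t)), ENNReal.toReal_mul] at e2
    have e3 : E (t + 1) (passageSum N.trans i g) ≤
        E t (ltransOp N.trans (passageSum N.trans i g)) +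
          ENNReal.ofReal δ * lmean N.trans N.init (passageSum N.trans i g) (t + 1) :=
      lintegral_backlog_succ_le hδ hδ0 harr hsrv p j t (passageSum N.trans i g)
    have e3' := ENNReal.toReal_mono (ENNReal.add_ne_top.2 ⟨hfin t _ (hLΦ t),
      ENNReal.mul_ne_top ENNReal.ofReal_ne_top (hΦt (t + 1))⟩) e3
    rw [ENNReal.toReal_add (hfin t _ (hLΦ t)) (ENNReal.mul_ne_top ENNReal.ofReal_ne_top
      (hΦt (t + 1))), ENNReal.toReal_mul, ENNReal.toReal_ofReal hδ0] at e3'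
    have e4 : E t (ltransOp N.trans (passageMean N.trans i)) ≤
        E (t + 1) (passageMean N.trans i) +
          ENNReal.ofReal δ * lmean N.trans N.init (passageMean N.trans i) (t + 1) :=
      lintegral_backlog_le_succ hδ hδ0 harr hsrv p j t (passageMean N.trans i)
    have e4' := ENNReal.toReal_mono (ENNReal.add_ne_top.2 ⟨hfin (t + 1) _ (hwt (t + 1)),
      ENNReal.mul_ne_top ENNReal.ofReal_ne_top (hwt (t + 1))⟩) e4
    rw [ENNReal.toReal_add (hfin (t + 1) _ (hwt (t + 1))) (ENNReal.mul_ne_top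
      ENNReal.ofReal_ne_top (hwt (t + 1))), ENNReal.toReal_mul, ENNReal.toReal_ofReal hδ0] at e4'
    have e5 : z (t + 1) + ENNReal.ofReal (2 * δ) * E t 1 ≤
        z t + ENNReal.ofReal (2 * δ ^ 2) + 2 * E t g := by
      rw [hEone]
      exact lintegral_backlog_sq_succ_le ρ hδ hδ0 harr hsrv j t
    have hE1 : E t 1 ≠ ⊤ := hfin t _ (hone t)
    have e5' := ENNReal.toReal_mono (ENNReal.add_ne_top.2 ⟨ENNReal.add_ne_top.2
      ⟨hzt t, ENNReal.ofReal_ne_top⟩, ENNReal.mul_ne_top ENNReal.ofNat_ne_top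
        (hfin t _ (hgt t))⟩) e5
    rw [ENNReal.toReal_add (hzt (t + 1)) (ENNReal.mul_ne_top ENNReal.ofReal_ne_top hE1),
      ENNReal.toReal_add (ENNReal.add_ne_top.2 ⟨hzt t, ENNReal.ofReal_ne_top⟩)
        (ENNReal.mul_ne_top ENNReal.ofNat_ne_top (hfin t _ (hgt t))),
      ENNReal.toReal_add (hzt t) ENNReal.ofReal_ne_top, ENNReal.toReal_mul, ENNReal.toReal_mul,
      ENNReal.toReal_ofReal (by positivity), ENNReal.toReal_ofReal (by positivity),
      ENNReal.toReal_ofNat] at e5'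
    have e6 := ENNReal.toReal_mono (ENNReal.mul_ne_top ENNReal.ofReal_ne_top (hwt (t + 1)))
      (hΦw (t + 1))
    rw [ENNReal.toReal_mul, ENNReal.toReal_ofReal (by positivity)] at e6
    have e7 := mul_le_mul_of_nonneg_left e6 hδ0
    have e8 := mul_le_mul_of_nonneg_left e4' ha0
    have e9 := mul_le_mul_of_nonneg_right haδ (mul_nonneg hδ0 (hm0 (t + 1)))
    have e10 := congrArg (fun v => a * v) e2
    simp only [hL, hη]
    linarith
  have hL0 : L 0 = 0 := by simp [hL, hz, hE, backlog]
  have hsum : ∀ t : ℕ, L t + η * ∑ τ ∈ Finset.range t, (E τ 1).toReal ≤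
      t * δ ^ 2 + 3 * δ ^ 2 * ∑ τ ∈ Finset.range t, m (τ + 1) := by
    intro t
    induction t with
    | zero => simp [hL0]
    | succ t ih =>
      rw [Finset.sum_range_succ, Finset.sum_range_succ, mul_add, mul_add]
      have := hstep t
      push_cast
      linarith
  -- The negative part `-a E[q w]` is absorbed by the quadratic term, at the price of the second
  -- passage moment.
  have hlow : ∀ t, -(4 * δ ^ 2 * W t) ≤ L t := by
    intro t
    have e1 : 2 * ENNReal.ofReal a * E t (passageMean N.trans i) ≤ z t +
        8 * (ENNReal.ofReal a * ENNReal.ofReal a) *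
          lmean N.trans N.init (passageQuad N.trans i) t :=
      lintegral_backlog_mul_passageMean_le hδ harr hsrv p j t hW (ENNReal.ofReal a)
    have hne : 8 * (ENNReal.ofReal a * ENNReal.ofReal a) *
        lmean N.trans N.init (passageQuad N.trans i) t ≠ ⊤ :=
      ENNReal.mul_ne_top (ENNReal.mul_ne_top ENNReal.ofNat_ne_top
        (ENNReal.mul_ne_top ENNReal.ofReal_ne_top ENNReal.ofReal_ne_top)) (hQt t)
    have e2 := ENNReal.toReal_mono (ENNReal.add_ne_top.2 ⟨hzt t, hne⟩) e1
    rw [ENNReal.toReal_add (hzt t) hne] at e2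
    simp only [ENNReal.toReal_mul, ENNReal.toReal_ofNat, ENNReal.toReal_ofReal ha0] at e2
    have e3 : a * a ≤ δ ^ 2 := by rw [sq]; exact mul_self_le_mul_self ha0 haδ
    have e4 := mul_le_mul_of_nonneg_right e3 (show 0 ≤ W t from ENNReal.toReal_nonneg)
    have e5 : 0 ≤ (E t (passageSum N.trans i g)).toReal := ENNReal.toReal_nonneg
    simp only [hL]
    linarith
  set A := (lexpect N.init (passageQuad N.trans i)).toReal with hA
  set C := (passageQuad N.trans i i).toReal with hC
  have hA0 : 0 ≤ A := ENNReal.toReal_nonneg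
  have hC0 : 0 ≤ C := ENNReal.toReal_nonneg
  have hWm : ∀ t : ℕ, W t + ∑ τ ∈ Finset.range t, m τ ≤ A + t * C := by
    intro t
    have hne : (t : ℝ≥0∞) * passageQuad N.trans i i ≠ ⊤ :=
      ENNReal.mul_ne_top (ENNReal.natCast_ne_top t) (hW i)
    have e1 := ENNReal.toReal_mono (ENNReal.add_ne_top.2 ⟨hinit, hne⟩)
      (lmean_passageQuad_add_sum_le (P := N.trans) (i := i) N.init t)
    rwa [ENNReal.toReal_add (hQt t) (ENNReal.sum_ne_top.2 fun τ _ => hwt τ),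
      ENNReal.toReal_sum fun τ _ => hwt τ, ENNReal.toReal_add hinit hne, ENNReal.toReal_mul,
      ENNReal.toReal_natCast] at e1
  -- The constant `7` is `3` from the step error plus `4` from the lower bound on `L`; `A + C`
  -- bounds the linear growth of the passage moments.
  refine ⟨(δ ^ 2 + 7 * δ ^ 2 * (A + C)) / η, fun t => ?_⟩
  have hreal : ∑ τ ∈ Finset.range t, (E τ 1).toReal ≤
      (δ ^ 2 + 7 * δ ^ 2 * (A + C)) / η * (t + 1) := by
    rw [div_mul_eq_mul_div, le_div_iff₀ hη0]
    have e1 := hsum t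
    have e2 := hlow t
    have e3 := hWm t
    have e4 := hWm (t + 1)
    rw [Finset.sum_range_succ'] at e4
    have e5 : 0 ≤ W (t + 1) := ENNReal.toReal_nonneg
    have e6 : 0 ≤ ∑ τ ∈ Finset.range t, m τ := Finset.sum_nonneg fun τ _ => hm0 τ
    have e7 : ∑ τ ∈ Finset.range t, m (τ + 1) ≤ A + (t + 1) * C := by
      push_cast at e4
      linarith [hm0 0]
    have e8 : W t ≤ A + t * C := by linarith
    have hδ2 : 0 ≤ δ ^ 2 := sq_nonneg δ
    have e9 := mul_le_mul_of_nonneg_left e7 hδ2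
    have e10 := mul_le_mul_of_nonneg_left e8 hδ2
    have e11 : 0 ≤ δ ^ 2 * (t * A) := by positivity
    have e12 : 0 ≤ δ ^ 2 * C := by positivity
    linarith
  have hE1 : ∀ τ, ∫⁻ ω, ENNReal.ofReal (N.backlog ω j τ) ∂μ = ENNReal.ofReal (E τ 1).toReal :=
    fun τ => by rw [ENNReal.ofReal_toReal (hfin τ _ (hone τ)), hEone]
  simp only [hE1]
  rw [← ENNReal.ofReal_sum_of_nonneg fun _ _ => ENNReal.toReal_nonneg]
  exact ENNReal.ofReal_le_ofReal hreal

/-- A stationary randomized policy with negative mean drifts is stable. -/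
theorem stable_stationaryPolicy (hδ : N.Bounded δ) (hδ0 : 0 ≤ δ)
    (harr : ∀ j s, Measurable (N.arr j s)) (hsrv : ∀ j s, Measurable (N.srv j s))
    (hirr : Irreducible N.trans) {π : PMF 𝒮} (hπ : IsStationary N.trans π) {i : 𝒮}
    (hW : ∀ s, passageQuad N.trans i s ≠ ⊤) (hinit : lexpect N.init (passageQuad N.trans i) ≠ ⊤)
    (hdrift : ∀ j, expect π (N.meanDrift ρ j) < 0) : N.Stable (stationaryPolicy ρ) := by
  choose K hK using fun j => exists_sum_backlog_le ρ hδ hδ0 harr hsrv hirr hπ hW hinit j (hdrift j)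
  -- The factor `2` comes from `t + 1 ≤ 2 t` for `t ≥ 1`.
  have hle : limsup (fun t : ℕ => (∑ τ ∈ Finset.range t, ∑ j : Fin r,
      ∫⁻ ω, ENNReal.ofReal (N.backlog ω j τ) ∂(N.law (stationaryPolicy ρ))) / (t : ℝ≥0∞)) atTop ≤
      ∑ j : Fin r, ENNReal.ofReal (K j) * 2 := by
    refine limsup_le_of_le (by isBoundedDefault) ?_
    filter_upwards [eventually_ge_atTop 1] with t ht
    refine ENNReal.div_le_of_le_mul ?_
    rw [Finset.sum_comm, Finset.sum_mul]
    refine Finset.sum_le_sum fun j _ => (hK j t).trans ?_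
    rw [ENNReal.ofReal_mul' (by positivity), mul_assoc]
    refine mul_le_mul_right ?_ _
    have h1 : (1 : ℝ) ≤ t := by exact_mod_cast ht
    rw [show (2 : ℝ≥0∞) * t = ENNReal.ofReal (2 * t) by
      rw [ENNReal.ofReal_mul zero_le_two, ENNReal.ofReal_natCast, ENNReal.ofReal_ofNat]]
    exact ENNReal.ofReal_le_ofReal (by linarith)
  refine hle.trans_lt (ENNReal.sum_lt_top.2 fun j _ => ?_)
  exact ENNReal.mul_lt_top ENNReal.ofReal_lt_top ENNReal.ofNat_lt_top

theorem avgCost_stationaryPolicy (hδ : N.Bounded δ) (hcost : ∀ s, Measurable (N.cost s))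
    (hirr : Irreducible N.trans) {π : PMF 𝒮} (hπ : IsStationary N.trans π) :
    N.avgCost (stationaryPolicy ρ) = expect π (N.meanCost ρ) := by
  refine Tendsto.limsup_eq ?_
  refine (tendsto_expect_cesaro hirr hπ (abs_meanCost_le ρ hδ) N.init).congr fun t => ?_
  congr 1
  refine Finset.sum_congr rfl fun τ _ => ?_
  exact (integral_stationary N ρ (k := fun z => N.cost z.1 z.2) (measurable_of_sigma hcost)
    (fun z => (hδ z.1 z.2).1) τ).symm

end Network

/-! ### Separation, and the convex set of achievable means. -/

/-- Lagrange multipliers for a convex set with a Slater point. -/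
theorem exists_multiplier {r : ℕ} {R : Set (ℝ × (Fin r → ℝ))} (hR : Convex ℝ R)
    {q₀ : ℝ × (Fin r → ℝ)} (hq₀ : q₀ ∈ R) (hslater : ∀ j, q₀.2 j < 0) {V v : ℝ}
    (hv : ∀ q ∈ R, (∀ j, q.2 j < 0) → v ≤ V * q.1) :
    ∃ γ : Fin r → ℝ, 0 ≤ γ ∧ ∀ q ∈ R, v ≤ V * q.1 + ∑ j, γ j * q.2 j := by
  -- Strict upper closure of the image of `R`. Strictness makes `C` open, and puts `(v, 0)` outside
  -- using `hv` only at points with strictly negative drifts.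
  set C : Set (ℝ × (Fin r → ℝ)) := {c | ∃ q ∈ R, V * q.1 < c.1 ∧ ∀ j, q.2 j < c.2 j} with hC
  have hopen : IsOpen C := by
    have e : C = ⋃ q ∈ R, {c | V * q.1 < c.1} ∩ ⋂ j, {c | q.2 j < c.2 j} := by
      ext c
      simp only [hC, Set.mem_ofPred_eq, Set.mem_iUnion, Set.mem_inter_iff, Set.mem_iInter,
        exists_prop]
    rw [e]
    refine isOpen_biUnion fun q _ => (isOpen_lt continuous_const continuous_fst).inter
      (isOpen_iInter_of_finite fun j => isOpen_lt continuous_const ?_)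
    exact (continuous_apply j).comp continuous_snd
  have hconv : Convex ℝ C := by
    rintro c ⟨q, hq, h1, h2⟩ c' ⟨q', hq', h1', h2'⟩ a b ha hb hab
    refine ⟨a • q + b • q', hR hq hq' ha hb hab, ?_, fun j => ?_⟩
    · simp only [Prod.fst_add, Prod.smul_fst, smul_eq_mul]
      rcases ha.eq_or_lt with rfl | ha'
      · have hb1 : b = 1 := by linarith
        subst hb1; simpa using h1'
      · nlinarith [mul_lt_mul_of_pos_left h1 ha', mul_le_mul_of_nonneg_left h1'.le hb]
    · simp only [Prod.snd_add, Prod.smul_snd, Pi.add_apply, Pi.smul_apply, smul_eq_mul]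
      rcases ha.eq_or_lt with rfl | ha'
      · have hb1 : b = 1 := by linarith
        subst hb1; simpa using h2' j
      · nlinarith [mul_lt_mul_of_pos_left (h2 j) ha', mul_le_mul_of_nonneg_left (h2' j).le hb]
  have hnot : (v, (0 : Fin r → ℝ)) ∉ C := by
    rintro ⟨q, hq, h1, h2⟩
    exact absurd (hv q hq h2) (not_le.2 h1)
  obtain ⟨f, hf⟩ := geometric_hahn_banach_open_point hconv hopen hnot
  set α : ℝ := -f (1, 0) with hα
  set β : Fin r → ℝ := fun j => -f (0, Pi.single j 1) with hβ
  have hform : ∀ y z, f (y, z) = -(α * y + ∑ j, β j * z j) := by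
    intro y z
    have e : ((y, z) : ℝ × (Fin r → ℝ)) =
        y • (1, 0) + ∑ j, z j • ((0 : ℝ), (Pi.single j 1 : Fin r → ℝ)) := by
      refine Prod.ext ?_ ?_
      · simp [Prod.fst_sum]
      · funext k
        simp [Prod.snd_sum, Finset.sum_apply, Pi.single_apply]
    rw [e, map_add, map_smul, map_sum]
    simp only [map_smul, smul_eq_mul, hα, hβ, neg_mul, Finset.sum_neg_distrib]
    rw [neg_add, neg_neg, neg_neg, mul_comm]
    congr 1
    exact Finset.sum_congr rfl fun j _ => mul_comm _ _
  have hsep : ∀ q ∈ R, ∀ (y : ℝ) (z : Fin r → ℝ), V * q.1 < y → (∀ j, q.2 j < z j) →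
      α * v < α * y + ∑ j, β j * z j := by
    intro q hq y z h1 h2
    have := hf (y, z) ⟨q, hq, h1, h2⟩
    rw [hform, hform] at this
    simp only [Pi.zero_apply, mul_zero, Finset.sum_const_zero, add_zero] at this
    linarith
  set y₁ := max (V * q₀.1) v + 1 with hy₁
  have hy₁q : V * q₀.1 < y₁ := (le_max_left _ _).trans_lt (lt_add_one _)
  have hy₁v : v < y₁ := (le_max_right _ _).trans_lt (lt_add_one _)
  -- The Slater point puts `(y₁, 0)` in `C` with `y₁ > v`, so the separating hyperplane is not
  -- vertical.
  have hαpos : 0 < α := by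
    have h1 := hsep q₀ hq₀ y₁ 0 hy₁q hslater
    simp only [Pi.zero_apply, mul_zero, Finset.sum_const_zero, add_zero] at h1
    have h2 : 0 < α * (y₁ - v) := by linarith
    exact (pos_iff_pos_of_mul_pos h2).2 (sub_pos.2 hy₁v)
  have hβ0 : ∀ j, 0 ≤ β j := by
    intro j
    by_contra! hneg
    -- Raising coordinate `j` stays in `C`; this `k` would make the separating value exactly `α v`,
    -- against strict separation.
    set k := α * (y₁ - v) / (-β j) with hk
    have hk0 : 0 ≤ k := div_nonneg (mul_nonneg hαpos.le (sub_nonneg.2 hy₁v.le)) (by linarith)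
    have h1 := hsep q₀ hq₀ y₁ (Pi.single j k) hy₁q fun i => (hslater i).trans_le (by
      rw [Pi.single_apply]; split_ifs <;> simp [hk0])
    have h2 : ∑ i, β i * (Pi.single j k : Fin r → ℝ) i = β j * k := by
      simp [Pi.single_apply]
    have h3 : β j * k = -(α * (y₁ - v)) := by
      rw [hk, div_neg, mul_neg, mul_div_cancel₀ _ hneg.ne]
    rw [h2, h3] at h1
    linarith
  refine ⟨fun j => β j / α, fun j => div_nonneg (hβ0 j) hαpos.le, fun q hq => ?_⟩
  have hmain : α * v ≤ α * (V * q.1) + ∑ j, β j * q.2 j := by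
    have hS : 0 < α + ∑ j, β j := add_pos_of_pos_of_nonneg hαpos (Finset.sum_nonneg fun j _ => hβ0 j)
    refine le_of_forall_pos_le_add fun ε hε => ?_
    -- The point `q` lies on the edge of `C`; this common shift of all coordinates costs exactly
    -- `ε`.
    have h1 := hsep q hq (V * q.1 + ε / (α + ∑ j, β j)) (fun j => q.2 j + ε / (α + ∑ j, β j))
      (by linarith [div_pos hε hS]) (fun j => by linarith [div_pos hε hS])
    simp only [mul_add, Finset.sum_add_distrib, ← Finset.sum_mul] at h1
    have h2 : α * (ε / (α + ∑ j, β j)) + (∑ j, β j) * (ε / (α + ∑ j, β j)) = ε := by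
      rw [← add_mul, mul_div_cancel₀ _ hS.ne']
    linarith
  have e : ∑ j, β j / α * q.2 j = (∑ j, β j * q.2 j) / α := by
    rw [Finset.sum_div]
    exact Finset.sum_congr rfl fun j _ => by ring
  rw [e, ← sub_le_iff_le_add', le_div_iff₀ hαpos]
  linarith

namespace Network

section Randomized

variable {r : ℕ} {𝒮 : Type*} {X : 𝒮 → Type*} [∀ s, MeasurableSpace (X s)]
  {N : Network r 𝒮 X} {δ : ℝ}

/-- The pairs of mean cost and mean drift achieved by randomized choices of the actions. -/
def achievable (N : Network r 𝒮 X) (π : PMF 𝒮) : Set (ℝ × (Fin r → ℝ)) :=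
  {q | ∃ ρ : ∀ s, Measure (X s), (∀ s, IsProbabilityMeasure (ρ s)) ∧
    q = (expect π (N.meanCost ρ), fun j => expect π (N.meanDrift ρ j))}

/-- Means are affine in the action laws, so mixing the laws state by state mixes the pairs. This
takes the place of convexity of the deterministic problem. -/
theorem convex_achievable (hδ : N.Bounded δ) (hcost : ∀ s, Measurable (N.cost s))
    (harr : ∀ j s, Measurable (N.arr j s)) (hsrv : ∀ j s, Measurable (N.srv j s)) (π : PMF 𝒮) :
    Convex ℝ (N.achievable π) := by
  rintro _ ⟨ρ, hρ, rfl⟩ _ ⟨ρ', hρ', rfl⟩ a b ha hb hab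
  have hint : ∀ s, ∀ f : X s → ℝ, Integrable f (ρ s) → Integrable f (ρ' s) →
      ∫ x, f x ∂(ENNReal.ofReal a • ρ s + ENNReal.ofReal b • ρ' s) =
        a * ∫ x, f x ∂(ρ s) + b * ∫ x, f x ∂(ρ' s) := by
    intro s f h1 h2
    rw [integral_add_measure (h1.smul_measure ENNReal.ofReal_ne_top)
      (h2.smul_measure ENNReal.ofReal_ne_top), integral_smul_measure, integral_smul_measure,
      ENNReal.toReal_ofReal ha, ENNReal.toReal_ofReal hb, smul_eq_mul, smul_eq_mul]
  have hexp : ∀ f f' : 𝒮 → ℝ, (∀ s, |f s| ≤ δ) → (∀ s, |f' s| ≤ δ) →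
      expect π (fun s => a * f s + b * f' s) = a * expect π f + b * expect π f' := by
    intro f f' h1 h2
    have k1 : ∀ s, |a * f s| ≤ a * δ := fun s => by
      rw [abs_mul, abs_of_nonneg ha]
      exact mul_le_mul_of_nonneg_left (h1 s) ha
    have k2 : ∀ s, |b * f' s| ≤ b * δ := fun s => by
      rw [abs_mul, abs_of_nonneg hb]
      exact mul_le_mul_of_nonneg_left (h2 s) hb
    rw [expect_add π k1 k2, expect_const_mul, expect_const_mul]
  refine ⟨fun s => ENNReal.ofReal a • ρ s + ENNReal.ofReal b • ρ' s, fun s => ⟨?_⟩, ?_⟩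
  · simp only [Measure.add_apply, Measure.smul_apply, measure_univ, smul_eq_mul, mul_one]
    rw [← ENNReal.ofReal_add ha hb, hab, ENNReal.ofReal_one]
  · refine Prod.ext ?_ (funext fun j => ?_)
    · have e : N.meanCost (fun s => ENNReal.ofReal a • ρ s + ENNReal.ofReal b • ρ' s) =
          fun s => a * N.meanCost ρ s + b * N.meanCost ρ' s := funext fun s =>
        hint s _ (integrable_cost_action ρ hδ hcost s) (integrable_cost_action ρ' hδ hcost s)
      simp only [e, hexp _ _ (abs_meanCost_le ρ hδ) (abs_meanCost_le ρ' hδ)]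
      rfl
    · have e : N.meanDrift (fun s => ENNReal.ofReal a • ρ s + ENNReal.ofReal b • ρ' s) j =
          fun s => a * N.meanDrift ρ j s + b * N.meanDrift ρ' j s := funext fun s =>
        hint s _ (integrable_drift_action ρ hδ harr hsrv j s)
          (integrable_drift_action ρ' hδ harr hsrv j s)
      simp only [e, hexp _ _ (abs_meanDrift_le ρ hδ j) (abs_meanDrift_le ρ' hδ j)]
      rfl

theorem achievable_of_slack (harr : ∀ j s, Measurable (N.arr j s))
    (hsrv : ∀ j s, Measurable (N.srv j s)) {π : PMF 𝒮} {η : ℝ} (hη : 0 < η) (h : N.Slack π η) :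
    ∃ q ∈ N.achievable π, ∀ j, q.2 j < 0 := by
  obtain ⟨x, θ, h0, h1, h2⟩ := h
  set ρ : ∀ s, Measure (X s) := fun s =>
    ∑ k, ENNReal.ofReal (θ s k) • Measure.dirac (x s k) with hρ
  have hprob : ∀ s, IsProbabilityMeasure (ρ s) := fun s => ⟨by
    simp only [hρ, Measure.finsetSum_apply, Measure.smul_apply, measure_univ, smul_eq_mul, mul_one]
    rw [← ENNReal.ofReal_sum_of_nonneg fun k _ => h0 s k, h1, ENNReal.ofReal_one]⟩
  refine ⟨_, ⟨ρ, hprob, rfl⟩, fun j => ?_⟩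
  have e : N.meanDrift ρ j = fun s => ∑ k, θ s k * (N.arr j s (x s k) - N.srv j s (x s k)) := by
    funext s
    have hm : StronglyMeasurable fun y => N.arr j s y - N.srv j s y :=
      ((harr j s).sub (hsrv j s)).stronglyMeasurable
    rw [meanDrift, integral_finsetSum_measure fun k _ => (integrable_dirac' hm
      (by simp)).smul_measure ENNReal.ofReal_ne_top]
    refine Finset.sum_congr rfl fun k _ => ?_
    rw [integral_smul_measure, integral_dirac' _ _ hm, ENNReal.toReal_ofReal (h0 s k), smul_eq_mul]
  change expect π (N.meanDrift ρ j) < 0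
  rw [e]
  exact (h2 j).trans_lt (neg_neg_of_pos hη)

/-- A deterministic selection is the family of its point masses, so a bound on achievable pairs
bounds every term of the infimum. -/
theorem le_dual (hδ : N.Bounded δ) [∀ s, Nonempty (X s)] (hcost : ∀ s, Measurable (N.cost s))
    (harr : ∀ j s, Measurable (N.arr j s)) (hsrv : ∀ j s, Measurable (N.srv j s)) {π : PMF 𝒮}
    {V v : ℝ} {γ : Fin r → ℝ}
    (h : ∀ q ∈ N.achievable π, v ≤ V * q.1 + ∑ j, γ j * q.2 j) : v ≤ N.dual π V γ := by
  refine le_ciInf fun x => ?_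
  refine (h _ ⟨fun s => Measure.dirac (x s), fun s => inferInstance, rfl⟩).trans_eq ?_
  have e1 : N.meanCost (fun s => Measure.dirac (x s)) = fun s => N.cost s (x s) :=
    funext fun s => integral_dirac' _ _ (hcost s).stronglyMeasurable
  have e2 : ∀ j, N.meanDrift (fun s => Measure.dirac (x s)) j =
      fun s => N.arr j s (x s) - N.srv j s (x s) := fun j =>
    funext fun s => integral_dirac' _ _ ((harr j s).sub (hsrv j s)).stronglyMeasurable
  have b1 : ∀ s, |V * N.cost s (x s)| ≤ |V| * δ := fun s => by
    rw [abs_mul]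
    exact mul_le_mul_of_nonneg_left (hδ s (x s)).1 (abs_nonneg _)
  have b2 : ∀ j s, |γ j * (N.arr j s (x s) - N.srv j s (x s))| ≤ |γ j| * δ := fun j s => by
    rw [abs_mul]
    exact mul_le_mul_of_nonneg_left (abs_drift_le hδ j s (x s)) (abs_nonneg _)
  have b3 : ∀ s, |∑ j, γ j * (N.arr j s (x s) - N.srv j s (x s))| ≤ ∑ j, |γ j| * δ := fun s =>
    (Finset.abs_sum_le_sum_abs _ _).trans (Finset.sum_le_sum fun j _ => b2 j s)
  simp only [e1, e2]
  change _ = expect π fun s => V * N.cost s (x s) +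
    ∑ j, γ j * (N.arr j s (x s) - N.srv j s (x s))
  rw [expect_add π b1 b3, expect_const_mul, expect_sum π _ b2]
  simp only [expect_const_mul]

end Randomized

end Network

end QueueNet

/-! ### Combination of weak and strong duality. -/

theorem theorem1 {r : ℕ} {𝒮 : Type*} [Countable 𝒮] {X : 𝒮 → Type*} [∀ s, MeasurableSpace (X s)]
    (N : QueueNet.Network r 𝒮 X)
    (hcost : ∀ s, Measurable (N.cost s))
    (harr : ∀ j s, Measurable (N.arr j s))
    (hsrv : ∀ j s, Measurable (N.srv j s))
    (δ : ℝ) (hδ : N.Bounded δ)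
    (hirr : QueueNet.Irreducible N.trans) (haper : QueueNet.Aperiodic N.trans)
    (π : PMF 𝒮) (hπ : QueueNet.IsStationary N.trans π)
    (s₁ : 𝒮) (hs₁ : ∀ j, QueueNet.passageSecondMoment N.trans s₁ j < ⊤)
    (hinit : ∑' j, N.init j * QueueNet.passageSecondMoment N.trans s₁ j < ⊤)
    (η : ℝ) (hη : 0 < η) (hslack : N.Slack π η)
    (V : ℝ) (hV : 0 < V) :
    IsGLB N.stableCosts N.optCost ∧
    (∃ γ, N.IsDualOptimal π V γ) ∧
    (∀ γ, N.IsDualOptimal π V γ → N.dual π V γ = V * N.optCost) ∧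
    (∀ γ : Fin r → ℝ, 0 ≤ γ → N.dual π V γ ≤ V * N.optCost) := by
  have hne : ∀ s, Nonempty (X s) := fun s => ⟨hslack.choose s 0⟩
  have hδ0 : 0 ≤ δ := (abs_nonneg _).trans (hδ s₁ (Classical.arbitrary _)).1
  have hWle := fun s => QueueNet.passageQuad_le_secondMoment (hs₁ s).ne
  have hW : ∀ s, QueueNet.passageQuad N.trans s₁ s ≠ ⊤ := fun s =>
    ne_top_of_le_ne_top (hs₁ s).ne (hWle s)
  have hWinit : QueueNet.lexpect N.init (QueueNet.passageQuad N.trans s₁) ≠ ⊤ :=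
    ne_top_of_le_ne_top hinit.ne (QueueNet.lexpect_mono N.init hWle)
  have hweak : ∀ γ : Fin r → ℝ, 0 ≤ γ → ∀ c ∈ N.stableCosts, N.dual π V γ ≤ V * c := by
    rintro γ hγ _ ⟨p, hp, rfl⟩
    exact hp.dual_le hδ hcost harr hsrv hirr hπ hV hγ
  have hmem : ∀ q ∈ N.achievable π, (∀ j, q.2 j < 0) → q.1 ∈ N.stableCosts := by
    rintro _ ⟨ρ, hρ, rfl⟩ hneg
    exact ⟨QueueNet.stationaryPolicy ρ, QueueNet.Network.stable_stationaryPolicy ρ hδ hδ0 harr hsrv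
      hirr hπ hW hWinit hneg, (QueueNet.Network.avgCost_stationaryPolicy ρ hδ hcost hirr hπ).symm⟩
  obtain ⟨q₀, hq₀, hslater⟩ := QueueNet.Network.achievable_of_slack harr hsrv hη hslack
  -- Slackness supplies a stable policy, and weak duality at `γ = 0` a lower bound, so the real
  -- infimum is genuine rather than a default value.
  have hglb : IsGLB N.stableCosts N.optCost := by
    refine isGLB_csInf ⟨q₀.1, hmem q₀ hq₀ hslater⟩ ⟨N.dual π V 0 / V, fun c hc => ?_⟩
    rw [div_le_iff₀ hV, mul_comm]
    exact hweak 0 le_rfl c hc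
  have hle : ∀ γ : Fin r → ℝ, 0 ≤ γ → N.dual π V γ ≤ V * N.optCost := fun γ hγ => by
    rw [mul_comm, ← div_le_iff₀ hV]
    refine hglb.2 fun c hc => ?_
    rw [div_le_iff₀ hV, mul_comm]
    exact hweak γ hγ c hc
  -- Only strictly negative drifts are known to give stability, and the multiplier argument asks for
  -- the bound at those points alone.
  obtain ⟨γ, hγ, hγle⟩ := QueueNet.exists_multiplier
    (QueueNet.Network.convex_achievable hδ hcost harr hsrv π) hq₀ hslater (V := V)
    (v := V * N.optCost) fun q hq hneg => mul_le_mul_of_nonneg_left (hglb.1 (hmem q hq hneg)) hV.le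
  have hge : V * N.optCost ≤ N.dual π V γ := QueueNet.Network.le_dual hδ hcost harr hsrv hγle
  refine ⟨hglb, ⟨γ, hγ, fun γ' hγ' => (hle γ' hγ').trans hge⟩, fun γ' hγ' => ?_, hle⟩
  exact le_antisymm (hle γ' hγ'.1) (hge.trans (hγ'.2 γ hγ))
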